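/- Let $\Sigma$ be a finite alphabet and let $P:\Sigma^*\times\mathbb N\to\mathbb N$ be a computable function. Then the following two statements are equivalent. 1. There are a computable function $f:\mathbb N\to\mathbb N$, a constant $c\in\mathbb N$ and an algorithm that, given $(x,k)\in\Sigma^*\times\mathbb N$, outputs $P(x,k)$ in time at most $f(k)\cdot\max(|x|,1)^{c}$. 2. There are a computable function $f:\mathbb N\to\mathbb N$ and a polynomial-time algorithm that, given $(x,k)\in\Sigma^*\times\mathbb N$, either (a) outputs the number $P(x,k)$, or (b) outputs a pair $(x',k')\in\Sigma^*\times\mathbb N$ with $|x'|\le f(k)$, $k'\le f(k)$ and $P(x,k)=P(x',k')$, where the output indicates which of the two cases applies. Here algorithms are deterministic multi-tape (equivalently, multi-stack) Turing machines and time is the number of steps. In every pair $(x,k)$, whether input or output, $k$ is written in unary, so that the size of $(x,k)$ is $|x|+k$ and polynomial time means time polynomial in $|x|+k$. The values of $P$ are output in binary. -/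

import Mathlib

open Computability Turing

/-- The string encoding of an instance `(x, k) ∈ α* × ℕ`: the string `x` followed by `k` in unary
(over disjoint alphabets). Its length is `|x| + k`, the usual size of a parameterized instance. -/
def instanceEncoding (α : Type) : Encoding (List α × ℕ) (α ⊕ Bool) :=
  encodingProd (encodingList α) unaryEncodingNat

theorem length_instanceEncoding (α : Type) (x : List α) (k : ℕ) :
    ((instanceEncoding α).encode (x, k)).length = x.length + k := by
  have h : ∀ n : ℕ, (unaryEncodeNat n).length = n := fun n => unary_decode_encode_nat n
  simp [instanceEncoding, encodingProd, encodingList, unaryEncodingNat, h]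

/-- The encoding of a disjoint union: a leading tag symbol tells the summand, and the encoding of
the element follows. -/
def encodingSum {β γ Γ₁ Γ₂ : Type} (eb : Encoding β Γ₁) (ec : Encoding γ Γ₂) :
    Encoding (β ⊕ γ) (Bool ⊕ (Γ₁ ⊕ Γ₂)) where
  encode
    | .inl b => .inl false :: (eb.encode b).map fun s => .inr (.inl s)
    | .inr c => .inl true :: (ec.encode c).map fun s => .inr (.inr s)
  decode
    | .inl false :: l =>
        (eb.decode (l.filterMap fun s => s.getRight?.bind Sum.getLeft?)).map .inl
    | .inl true :: l =>
        (ec.decode (l.filterMap fun s => s.getRight?.bind Sum.getRight?)).map .inr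
    | _ => none
  decode_encode y := by
    cases y <;> simp [List.filterMap_map, Function.comp_def]

/-- `P : α* × ℕ → ℕ` is a (total) computable function: some Turing machine (Mathlib's multi-stack
machine `FinTM2`), started on the encoding of `(x, k)`, halts and outputs `P (x, k)` in binary. -/
def ComputableCounting {α : Type} (P : List α × ℕ → ℕ) : Prop :=
  Nonempty (TM2Computable (instanceEncoding α).encode encodingNatBool.encode P)

/-- `P` is fixed-parameter tractable: for some computable `f` and some constant `c`, a Turing machine
outputs `P (x, k)` in binary within `f k * |x| ^ c` steps, for every instance `(x, k)`. In the bound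
`|x|` is read as `1` for the empty string, since no machine halts within `0` steps. -/
def FPTCounting {α : Type} (P : List α × ℕ → ℕ) : Prop :=
  ∃ f : ℕ → ℕ, Computable f ∧
    ∃ (M : TM2ComputableAux (α ⊕ Bool) Bool) (c : ℕ), ∀ (x : List α) (k : ℕ),
      Nonempty (TM2OutputsInTime M.tm
        (((instanceEncoding α).encode (x, k)).map M.inputAlphabet.symm)
        (some ((encodingNatBool.encode (P (x, k))).map M.outputAlphabet.symm))
        (f k * max x.length 1 ^ c))

/-- `P` has a counting kernel: for some computable `f` there is a polynomial-time algorithm whose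
output on `(x, k)` is either the number `P (x, k)` or an instance `(x', k')` with `|x'|, k' ≤ f k`
and the same value. -/
def HasCountingKernel {α : Type} (P : List α × ℕ → ℕ) : Prop :=
  ∃ f : ℕ → ℕ, Computable f ∧
    ∃ A : List α × ℕ → ℕ ⊕ (List α × ℕ),
      Nonempty (TM2ComputableInPolyTime (instanceEncoding α).encode
        (encodingSum encodingNatBool (instanceEncoding α)).encode A) ∧
      ∀ (x : List α) (k : ℕ),
        A (x, k) = .inl (P (x, k)) ∨
        ∃ (x' : List α) (k' : ℕ), A (x, k) = .inr (x', k') ∧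
          x'.length ≤ f k ∧ k' ≤ f k ∧ P (x, k) = P (x', k')

/-! Let n = |x| + k. Suppose P is computed in t ≤ f(k)·max(|x|,1)^c steps. Run this algorithm under
a clock that allows fewer than (n+1)^(c+1) steps. If it halts, its output is the value. Otherwise
(n+1)^(c+1) ≤ t ≤ f(k)·(n+1)^c, so n < f(k), and the instance is its own kernel.

Conversely, run the kernelization and, if it returns an instance, run any machine for P on that
instance. It is one of the finitely many with |x'|, k' ≤ f(k), so the second run takes at most
g(f(k)) steps. Here g is computable because the machine halts on all these instances and can be
simulated. The polynomial part of the time splits by n + 1 ≤ (k+2)·max(|x|,1).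

The work lies in the machines. `Clocked.exists_polynomial_outputsInTime` gives the clocked run; its
counter (`Clocked.tick_step`) is operated within the simulated steps. `Handoff.exists_outputsInTime`
chains two machines. `exists_computable_time_bound` passes from Turing machines to `Computable`
through a primitive recursive step function. A machine must halt in its initial state with every
stack but the output empty, so an interrupted run has to be cleaned up; `exists_growth_bound` bounds
what there is to clean. -/

open Function (update)

/-! ### Exact step counts -/

/-- `f` takes `a` to `b` in exactly `n` steps. -/
def StepsTo {σ : Type} (f : σ → Option σ) (n : ℕ) (a b : σ) : Prop :=
  (flip bind f)^[n] (some a) = some b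

namespace StepsTo

variable {σ : Type} {f : σ → Option σ} {m n : ℕ} {a b c : σ}

theorem refl (a : σ) : StepsTo f 0 a a := rfl

theorem head (h : f a = some b) (h' : StepsTo f n b c) : StepsTo f (n + 1) a c := by
  have : flip bind f (some a) = some b := by simp [flip, h]
  rwa [StepsTo, Function.iterate_succ_apply, this]

theorem single (h : f a = some b) : StepsTo f 1 a b := head h (refl b)

theorem trans (h : StepsTo f m a b) (h' : StepsTo f n b c) : StepsTo f (m + n) a c := by
  rw [StepsTo, add_comm, Function.iterate_add_apply, h, h']

theorem iterate_none (n : ℕ) : (flip bind f)^[n] none = none :=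
  Function.iterate_fixed rfl n

theorem exists_head (h : StepsTo f (n + 1) a c) : ∃ b, f a = some b ∧ StepsTo f n b c := by
  rw [StepsTo, Function.iterate_succ_apply] at h
  cases hb : f a with
  | none =>
    have : flip bind f (some a) = none := by simp [flip, hb]
    rw [this, iterate_none] at h
    cases h
  | some b =>
    have : flip bind f (some a) = some b := by simp [flip, hb]
    exact ⟨b, rfl, by rwa [this] at h⟩

theorem exists_mid (h : StepsTo f (m + n) a c) : ∃ b, StepsTo f m a b ∧ StepsTo f n b c := by
  induction m generalizing a with
  | zero => exact ⟨a, refl a, by simpa using h⟩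
  | succ m ih =>
    rw [Nat.succ_add] at h
    obtain ⟨a', ha, h⟩ := h.exists_head
    obtain ⟨b, hb, h⟩ := ih h
    exact ⟨b, head ha hb, h⟩

end StepsTo

/-! ### Initial and final configurations, stack growth, embedding of programs -/

namespace Turing

theorem initList_eq (tm : FinTM2) (s : List (tm.Γ tm.k₀)) :
    initList tm s = ⟨some tm.main, tm.initialState, update (fun _ => []) tm.k₀ s⟩ := by
  unfold initList
  congr 1
  funext k
  by_cases h : k = tm.k₀
  · subst h; simp
  · simp [h]

theorem haltList_eq (tm : FinTM2) (s : List (tm.Γ tm.k₁)) :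
    haltList tm s = ⟨none, tm.initialState, update (fun _ => []) tm.k₁ s⟩ := by
  unfold haltList
  congr 1
  funext k
  by_cases h : k = tm.k₁
  · subst h; simp
  · simp [h]

theorem TM2Outputs.exists_stepsTo {tm : FinTM2} {l : List (tm.Γ tm.k₀)} {l' : List (tm.Γ tm.k₁)}
    (h : TM2Outputs tm l (some l')) :
    ∃ n, StepsTo tm.step n (initList tm l) (haltList tm l') :=
  ⟨h.steps, h.evals_in_steps⟩

theorem nonempty_TM2OutputsInTime {tm : FinTM2} {l : List (tm.Γ tm.k₀)}
    {l' : List (tm.Γ tm.k₁)} {t : ℕ} :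
    Nonempty (TM2OutputsInTime tm l (some l') t) ↔
      ∃ n ≤ t, StepsTo tm.step n (initList tm l) (haltList tm l') :=
  ⟨fun ⟨h⟩ => ⟨h.steps, h.steps_le_m, h.evals_in_steps⟩, fun ⟨n, hn, h⟩ => ⟨⟨⟨n, h⟩, hn⟩⟩⟩

namespace TM2

section Growth

variable {K : Type} [DecidableEq K] {Γ : K → Type} {Λ σ : Type}

/-- A bound on the number of symbols pushed by a statement. -/
def Stmt.pushCount : Stmt Γ Λ σ → ℕ
  | .push _ _ q => q.pushCount + 1
  | .peek _ _ q => q.pushCount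
  | .pop _ _ q => q.pushCount
  | .load _ q => q.pushCount
  | .branch _ q₁ q₂ => q₁.pushCount + q₂.pushCount
  | .goto _ => 0
  | .halt => 0

theorem length_stepAux_stk_le (q : Stmt Γ Λ σ) (v : σ) (S : ∀ k, List (Γ k)) (k : K) :
    ((stepAux q v S).stk k).length ≤ (S k).length + q.pushCount := by
  induction q generalizing v S with
  | push k' f q ih =>
    refine (ih _ _).trans ?_
    by_cases h : k = k'
    · subst h; simp [Stmt.pushCount]; omega
    · simp [h, Stmt.pushCount]
  | peek k' f q ih => exact ih _ _
  | pop k' f q ih =>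
    refine (ih _ _).trans ?_
    by_cases h : k = k'
    · subst h; simp [Stmt.pushCount]
    · simp [h, Stmt.pushCount]
  | load f q ih => exact ih _ _
  | branch f q₁ q₂ ih₁ ih₂ =>
    cases h : f v
    · have := ih₂ v S
      simp only [stepAux, h, cond_false, Stmt.pushCount]; omega
    · have := ih₁ v S
      simp only [stepAux, h, cond_true, Stmt.pushCount]; omega
  | goto f => simp [Stmt.pushCount]
  | halt => simp [Stmt.pushCount]

/-- A step executes one statement, and there are finitely many labels, so the sum of all push counts
bounds the growth per step. This bounds output lengths and the cost of emptying stacks. -/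
theorem exists_growth_bound [Finite Λ] (m : Λ → Stmt Γ Λ σ) :
    ∃ B, ∀ n c c', StepsTo (step m) n c c' → ∀ k,
      (c'.stk k).length ≤ (c.stk k).length + n * B := by
  have := Fintype.ofFinite Λ
  refine ⟨∑ l, (m l).pushCount, fun n => ?_⟩
  induction n with
  | zero =>
    intro c c' h k
    cases h
    simp
  | succ n ih =>
    intro c c' h k
    obtain ⟨b, hb, h⟩ := h.exists_head
    refine (ih _ _ h k).trans ?_
    obtain ⟨l | l, v, S⟩ := c
    · cases hb
    · cases hb
      have h₁ := length_stepAux_stk_le (m l) v S k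
      have h₂ := Finset.single_le_sum (f := fun l => (m l).pushCount) (fun _ _ => Nat.zero_le _)
        (Finset.mem_univ l)
      rw [Nat.succ_mul]
      dsimp only at h₂ ⊢
      omega

end Growth

section Lift

variable {K K' : Type} [DecidableEq K] [DecidableEq K'] {Λ Λ' σ σ' : Type}

/-- Embeds a statement into a machine with more stacks, labels and states. The stacks are renamed
by `e`, the labels by `g`, the state is accessed by `get` and `set`, and halting is replaced by
`q₀`. -/
def liftStmt (e : K → K') (Γ' : K' → Type) (get : σ' → σ) (set : σ → σ' → σ') (g : Λ → Λ')
    (q₀ : Stmt Γ' Λ' σ') : Stmt (fun k => Γ' (e k)) Λ σ → Stmt Γ' Λ' σ'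
  | .push k f q => .push (e k) (fun v => f (get v)) (liftStmt e Γ' get set g q₀ q)
  | .peek k f q => .peek (e k) (fun v o => set (f (get v) o) v) (liftStmt e Γ' get set g q₀ q)
  | .pop k f q => .pop (e k) (fun v o => set (f (get v) o) v) (liftStmt e Γ' get set g q₀ q)
  | .load f q => .load (fun v => set (f (get v)) v) (liftStmt e Γ' get set g q₀ q)
  | .branch f q₁ q₂ => .branch (fun v => f (get v)) (liftStmt e Γ' get set g q₀ q₁)
      (liftStmt e Γ' get set g q₀ q₂)
  | .goto f => .goto fun v => g (f (get v))
  | .halt => q₀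

variable {e : K → K'} {Γ' : K' → Type} {get : σ' → σ} {set : σ → σ' → σ'} {g : Λ → Λ'}
  {q₀ : Stmt Γ' Λ' σ'} {p : σ → σ'} {ov : (∀ k, List (Γ' (e k))) → ∀ k', List (Γ' k')}

/-- Here `p` puts an inner state into a fixed outer state, and `ov` puts inner stacks among fixed
outer ones. The hypotheses say that the inner program sees and changes only its own share, so
execution commutes with the embedding until `q₀` takes the place of halting. -/
theorem stepAux_liftStmt (hget : ∀ s, get (p s) = s) (hset : ∀ s t, set s (p t) = p s)
    (hov : ∀ S k, ov S (e k) = S k)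
    (hupdate : ∀ S k x, update (ov S) (e k) x = ov (update S k x))
    (q : Stmt (fun k => Γ' (e k)) Λ σ) (v : σ) (S : ∀ k, List (Γ' (e k))) :
    stepAux (liftStmt e Γ' get set g q₀ q) (p v) (ov S) =
      (stepAux q v S).l.elim (stepAux q₀ (p (stepAux q v S).var) (ov (stepAux q v S).stk))
        fun l => ⟨some (g l), p (stepAux q v S).var, ov (stepAux q v S).stk⟩ := by
  induction q generalizing v S with
  | push k f q ih => simp only [liftStmt, stepAux, hget, hov, hupdate, ih]
  | peek k f q ih => simp only [liftStmt, stepAux, hget, hset, hov, ih]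
  | pop k f q ih => simp only [liftStmt, stepAux, hget, hset, hov, hupdate, ih]
  | load f q ih => simp only [liftStmt, stepAux, hget, hset, ih]
  | branch f q₁ q₂ ih₁ ih₂ =>
    simp only [liftStmt, stepAux, hget]
    cases f v
    · exact ih₂ _ _
    · exact ih₁ _ _
  | goto f => simp only [liftStmt, stepAux, hget, Option.elim]
  | halt => rfl

end Lift

end TM2

end Turing

/-! ### Emptying stacks -/

namespace Turing.TM2

section Drain

variable {K : Type} [DecidableEq K] {Γ : K → Type} {Λ σ : Type}

/-- Pops the stacks in `ks`, applying `mark` to the state for each nonempty one. -/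
def popAll (mark : σ → σ) (q : Stmt Γ Λ σ) : List K → Stmt Γ Λ σ
  | [] => q
  | k :: ks => .pop k (fun v o => if o.isSome then mark v else v) (popAll mark q ks)

theorem stepAux_popAll {mark : σ → σ} (hmark : ∀ v, mark (mark v) = mark v) (q : Stmt Γ Λ σ)
    {ks : List K} (hks : ks.Nodup) (v : σ) (S : ∀ k, List (Γ k)) :
    stepAux (popAll mark q ks) v S =
      stepAux q (if ∃ k ∈ ks, S k ≠ [] then mark v else v)
        (fun k => if k ∈ ks then (S k).tail else S k) := by
  induction ks generalizing v S with
  | nil => simp [popAll]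
  | cons k ks ih =>
    obtain ⟨hk, hks⟩ := List.nodup_cons.1 hks
    have hne : ∀ k' ∈ ks, k' ≠ k := fun k' h h' => hk (h' ▸ h)
    rw [popAll, stepAux, ih hks]
    have hex : (∃ k' ∈ ks, update S k (S k).tail k' ≠ []) ↔ ∃ k' ∈ ks, S k' ≠ [] :=
      exists_congr fun k' => and_congr_right fun h => by rw [Function.update_of_ne (hne k' h)]
    congr 1
    · simp only [hex, List.exists_mem_cons_iff]
      cases hS : S k with
      | nil => simp
      | cons a l =>
        by_cases h : ∃ k' ∈ ks, S k' ≠ []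
        · simp [h, hmark]
        · simp [h]
    · funext k'
      by_cases h : k' = k
      · subst h; simp [hk]
      · simp [h]

/-- Pops the stacks in `ks` until they are empty, then resets the state to `v₀` and continues with
`l'`. It is to be run at label `l`. -/
def drain (mark unmark : σ → σ) (marked : σ → Bool) (v₀ : σ) (l l' : Λ) (ks : List K) :
    Stmt Γ Λ σ :=
  .load unmark <| popAll mark
    (.branch marked (.goto fun _ => l) (.load (fun _ => v₀) (.goto fun _ => l'))) ks

/-- All stacks are popped in the same step, so the tallest one determines the time. The extra step
is the round that finds everything empty. Since each round begins with `unmark`, a mark at its end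
means that this round popped a symbol. -/
theorem exists_stepsTo_drain {m : Λ → Stmt Γ Λ σ} {mark unmark : σ → σ} {marked : σ → Bool}
    {v₀ : σ} {l l' : Λ} {ks : List K} (hm : m l = drain mark unmark marked v₀ l l' ks)
    (hmark : ∀ v, mark (mark v) = mark v) (hmarked : ∀ v, marked (mark v) = true)
    (hunmark : ∀ v, marked (unmark v) = false) (hks : ks.Nodup) (N : ℕ) (v : σ)
    (S : ∀ k, List (Γ k)) (hS : ∀ k ∈ ks, (S k).length ≤ N) :
    ∃ n ≤ N + 1, StepsTo (step m) n ⟨some l, v, S⟩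
      ⟨some l', v₀, fun k => if k ∈ ks then [] else S k⟩ := by
  induction N generalizing v S with
  | zero =>
    have hS' : ∀ k ∈ ks, S k = [] := fun k hk => List.length_eq_zero_iff.1 (by simpa using hS k hk)
    refine ⟨1, le_rfl, .single ?_⟩
    have h : ¬∃ k ∈ ks, S k ≠ [] := by simpa using hS'
    simp only [step, hm, drain, stepAux, stepAux_popAll hmark _ hks, h, if_false, hunmark,
      cond_false]
    congr 2
    funext k
    split_ifs with hk
    · rw [hS' k hk]; rfl
    · rfl
  | succ N ih =>
    by_cases h : ∃ k ∈ ks, S k ≠ []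
    · obtain ⟨n, hn, hn'⟩ := ih (mark (unmark v)) (fun k => if k ∈ ks then (S k).tail else S k)
        fun k hk => by
          have := hS k hk
          simp [hk]; omega
      refine ⟨n + 1, by omega, .head (b := ⟨some l, mark (unmark v), fun k =>
        if k ∈ ks then (S k).tail else S k⟩) ?_ ?_⟩
      · simp only [step, hm, drain, stepAux, stepAux_popAll hmark _ hks, h, if_true, hmarked,
          cond_true]
      · convert hn' using 3 with k
        split_ifs <;> rfl
    · have hS' : ∀ k ∈ ks, S k = [] := by simpa using h
      obtain ⟨n, hn, hn'⟩ := ih v S fun k hk => by simp [hS' k hk]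
      exact ⟨n, by omega, hn'⟩

end Drain

end Turing.TM2

/-! ### A clock with polynomially many ticks -/

/-- The stacks that a clocked machine has in addition to those of the machine that it runs. -/
inductive ClockedStack (d : ℕ)
  | inp
  | rev
  | buf (b : Bool)
  | out
  | clk (i : Fin d) (b : Bool)
  deriving DecidableEq, Fintype

/-- The labels of a clocked machine. -/
inductive ClockedLabel (Λ : Type)
  | scan
  | fill
  | sim (l : Λ)
  | collect
  | clean (b : Bool)
  | emit (b : Bool)
  deriving Fintype

/-- The states of a clocked machine. -/
structure ClockedState (σ β : Type) (d : ℕ) where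
  inner : σ
  dir : Fin d → Bool
  sym : Option (Bool ⊕ β)

def ClockedState.equivProd (σ β : Type) (d : ℕ) :
    ClockedState σ β d ≃ σ × (Fin d → Bool) × Option (Bool ⊕ β) where
  toFun v := (v.inner, v.dir, v.sym)
  invFun v := ⟨v.1, v.2.1, v.2.2⟩

noncomputable instance {σ β : Type} {d : ℕ} [Finite σ] [Finite β] :
    Fintype (ClockedState σ β d) :=
  have := Finite.of_equiv _ (ClockedState.equivProd σ β d).symm
  Fintype.ofFinite _

namespace Clocked

open ClockedStack ClockedLabel Turing.TM2

variable {K Λ σ β : Type} [DecidableEq K] {Γ : K → Type} {d : ℕ}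

/-- The alphabets of a clocked machine. -/
def Alphabet (Γ : K → Type) (β : Type) (d : ℕ) : K ⊕ ClockedStack d → Type
  | .inl k => Γ k
  | .inr inp => β
  | .inr rev => β
  | .inr (buf _) => Bool ⊕ β
  | .inr out => Bool ⊕ (Bool ⊕ β)
  | .inr (clk _ _) => Unit

/-- The symbol on the stacks of the clock. -/
def token (i : Fin d) (b : Bool) : Alphabet Γ β d (.inr (clk i b)) := ()

/-- The statements of a clocked machine. -/
abbrev CStmt (Γ : K → Type) (Λ σ β : Type) (d : ℕ) : Type :=
  Stmt (Alphabet Γ β d) (ClockedLabel Λ) (ClockedState σ β d)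

/-- The configurations of a clocked machine. -/
abbrev CCfg (Γ : K → Type) (Λ σ β : Type) (d : ℕ) : Type :=
  Cfg (Alphabet Γ β d) (ClockedLabel Λ) (ClockedState σ β d)

/-- The stacks of a clocked machine, assembled from their contents. -/
def contents (S : ∀ k, List (Γ k)) (i r : List β) (b : Bool → List (Bool ⊕ β))
    (o : List (Bool ⊕ (Bool ⊕ β))) (c : Fin d → Bool → ℕ) :
    ∀ k, List (Alphabet Γ β d k)
  | .inl k => S k
  | .inr inp => i
  | .inr rev => r
  | .inr (buf x) => b x
  | .inr out => o
  | .inr (clk j x) => List.replicate (c j x) ()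

section Contents

variable (S : ∀ k, List (Γ k)) (i r : List β) (b : Bool → List (Bool ⊕ β))
    (o : List (Bool ⊕ (Bool ⊕ β))) (c : Fin d → Bool → ℕ)

/-- This and the next lemmas bring every configuration back to the form `contents …` after a stack
operation. -/
theorem update_inl (k : K) (x : List (Alphabet Γ β d (.inl k))) :
    update (contents S i r b o c) (.inl k) x = contents (update S k x) i r b o c := by
  refine Function.update_eq_iff.2 ⟨(Function.update_self k x S).symm, fun k' h => ?_⟩
  rcases k' with k' | k'
  · have h' : k' ≠ k := fun h' => h (h' ▸ rfl)
    exact (Function.update_of_ne h' x S).symm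
  · cases k' <;> rfl

theorem update_inp (x : List (Alphabet Γ β d (.inr inp))) :
    update (contents S i r b o c) (.inr inp) x = contents S x r b o c := by
  refine Function.update_eq_iff.2 ⟨rfl, fun k' h => ?_⟩
  rcases k' with k' | k' | k' | k' | k' | k' <;> first | rfl | exact absurd rfl h

theorem update_rev (x : List (Alphabet Γ β d (.inr rev))) :
    update (contents S i r b o c) (.inr rev) x = contents S i x b o c := by
  refine Function.update_eq_iff.2 ⟨rfl, fun k' h => ?_⟩
  rcases k' with k' | k' | k' | k' | k' | k' <;> first | rfl | exact absurd rfl h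

theorem update_out (x : List (Alphabet Γ β d (.inr out))) :
    update (contents S i r b o c) (.inr out) x = contents S i r b x c := by
  refine Function.update_eq_iff.2 ⟨rfl, fun k' h => ?_⟩
  rcases k' with k' | k' | k' | k' | k' | k' <;> first | rfl | exact absurd rfl h

theorem update_buf (y : Bool) (x : List (Alphabet Γ β d (.inr (buf y)))) :
    update (contents S i r b o c) (.inr (buf y)) x = contents S i r (update b y x) o c := by
  refine Function.update_eq_iff.2 ⟨(Function.update_self y x b).symm, fun k' h => ?_⟩
  rcases k' with k' | k' | k' | z | k' | k' <;> try rfl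
  have h' : z ≠ y := fun h' => h (h' ▸ rfl)
  exact (Function.update_of_ne h' x b).symm

theorem update_clk (j : Fin d) (y : Bool) (x : List (Alphabet Γ β d (.inr (clk j y)))) :
    update (contents S i r b o c) (.inr (clk j y)) x =
      contents S i r b o (update c j (update (c j) y x.length)) := by
  refine Function.update_eq_iff.2 ⟨?_, fun k' h => ?_⟩
  -- A list over `Unit` is determined by its length, so recording token counts loses nothing.
  · have : x = List.replicate x.length () := List.eq_replicate_iff.2 ⟨rfl, fun _ _ => rfl⟩
    have hx : update c j (update (c j) y x.length) j y = x.length := by simp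
    simp only [contents, hx]
    exact this
  · rcases k' with k' | k' | k' | k' | k' | ⟨j', z⟩ <;> try rfl
    by_cases hj : j' = j
    · subst hj
      have hz : z ≠ y := fun h' => h (h' ▸ rfl)
      simp [contents, hz]
    · simp [contents, hj]

omit [DecidableEq K] in
theorem length_contents_clk (j : Fin d) (y : Bool) :
    (contents S i r b o c (.inr (clk j y))).length = c j y :=
  List.length_replicate

omit [DecidableEq K] in
theorem isSome_head?_contents_clk (j : Fin d) (y : Bool) :
    (contents S i r b o c (.inr (clk j y))).head?.isSome = decide (0 < c j y) := by
  rw [Bool.eq_iff_iff, List.isSome_head?, List.ne_nil_iff_length_pos, length_contents_clk,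
    decide_eq_true_iff]

end Contents

/-- Moves one token of the clock and continues with `q₁`, or continues with `q₂` if the clock has
run out. A digit of the clock is a number of tokens, distributed over two stacks. The least
significant digit that has a token left to be moved changes, and all digits before it change their
direction. -/
def tick (q₁ q₂ : CStmt Γ Λ σ β d) [Inhabited β] : List (Fin d) → CStmt Γ Λ σ β d
  | [] => q₂
  | i :: is =>
    .branch (fun v => v.dir i)
      (.pop (.inr (clk i true)) (fun v o => { v with sym := o.map fun _ => .inl true })
        (.branch (fun v => v.sym.isSome)
          (.load (fun v => { v with sym := none })
            (.push (.inr (clk i false)) (fun _ => token i false) q₁))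
          (.load (fun v => { v with dir := update v.dir i false }) (tick q₁ q₂ is))))
      (.pop (.inr (clk i false)) (fun v o => { v with sym := o.map fun _ => .inl true })
        (.branch (fun v => v.sym.isSome)
          (.load (fun v => { v with sym := none })
            (.push (.inr (clk i true)) (fun _ => token i true) q₁))
          (.load (fun v => { v with dir := update v.dir i true }) (tick q₁ q₂ is))))

/-- The number of ticks left on a clock with `n` tokens for each digit. -/
def remaining (n : ℕ) (dir : Fin d → Bool) (c : Fin d → Bool → ℕ) : List (Fin d) → ℕ
  | [] => 0
  | i :: is => c i (dir i) + (n + 1) * remaining n dir c is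

theorem remaining_congr {n : ℕ} {dir dir' : Fin d → Bool} {c c' : Fin d → Bool → ℕ}
    {is : List (Fin d)} (h : ∀ i ∈ is, dir i = dir' i ∧ c i = c' i) :
    remaining n dir c is = remaining n dir' c' is := by
  induction is with
  | nil => rfl
  | cons i is ih =>
    simp only [List.forall_mem_cons] at h
    simp only [remaining, ih h.2, h.1.1, h.1.2]

/-- A full clock shows the largest number with the given digits in base n + 1. -/
theorem remaining_full (n : ℕ) (is : List (Fin d)) :
    remaining n (fun _ => true) (fun _ b => if b then n else 0) is + 1 = (n + 1) ^ is.length := by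
  induction is with
  | nil => rfl
  | cons i is ih =>
    simp only [remaining, if_true, List.length_cons, pow_succ, ← ih]
    ring

/-- The value of a digit is the number of tokens on the stack that its direction points to. Since
both stacks together always hold `n` tokens, reversing the direction of a digit 0 makes it `n`: this
is the borrow of a subtraction in base n + 1, and no digit has to be refilled. The clause about `i ∉
is` keeps the lower digits fixed while the borrow is passed on. -/
theorem tick_step [Inhabited β] (q₁ q₂ : CStmt Γ Λ σ β d) (n : ℕ) (s : σ) (S : ∀ k, List (Γ k))
    (i r : List β) (b : Bool → List (Bool ⊕ β)) (o : List (Bool ⊕ (Bool ⊕ β)))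
    {is : List (Fin d)} (his : is.Nodup) (dir : Fin d → Bool) (c : Fin d → Bool → ℕ)
    (hc : ∀ i, c i true + c i false = n) (x : Option (Bool ⊕ β)) :
    ∃ dir' c' x', (∀ i, c' i true + c' i false = n) ∧
      (∀ i ∉ is, dir' i = dir i ∧ c' i = c i) ∧
      ((remaining n dir c is = 0 ∧ stepAux (tick q₁ q₂ is) ⟨s, dir, x⟩ (contents S i r b o c) =
        stepAux q₂ ⟨s, dir', x'⟩ (contents S i r b o c')) ∨
      (remaining n dir c is = remaining n dir' c' is + 1 ∧
        stepAux (tick q₁ q₂ is) ⟨s, dir, x⟩ (contents S i r b o c) =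
        stepAux q₁ ⟨s, dir', none⟩ (contents S i r b o c'))) := by
  induction is generalizing dir c x with
  | nil => exact ⟨dir, c, x, hc, fun _ _ => ⟨rfl, rfl⟩, .inl ⟨rfl, rfl⟩⟩
  | cons j is ih =>
    obtain ⟨hj, his⟩ := List.nodup_cons.1 his
    obtain ⟨y, hy⟩ : ∃ y, dir j = y := ⟨_, rfl⟩
    cases hcj : c j y with
    -- Borrow: the digit flips from 0 to `n`, and the tick passes to the higher digits.
    | zero =>
      obtain ⟨dir', c', x', hc', hout, h⟩ := ih his (update dir j (!y)) c hc none
      have hdir' : dir' j = !y := by simp [(hout j hj).1]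
      have hrem : remaining n (update dir j (!y)) c is = remaining n dir c is :=
        remaining_congr fun i hi => by
          have : i ≠ j := fun h => hj (h ▸ hi)
          simp [this]
      have hn : c j (!y) = n := by
        have := hc j
        cases y <;> simp_all
      have hstep : stepAux (tick q₁ q₂ (j :: is)) ⟨s, dir, x⟩ (contents S i r b o c) =
          stepAux (tick q₁ q₂ is) ⟨s, update dir j (!y), none⟩ (contents S i r b o c) := by
        have hcc : update c j (update (c j) y 0) = c := by rw [← hcj]; simp
        cases y <;> simp [tick, hy, stepAux, update_clk, contents, hcj, hcc]
      refine ⟨dir', c', x', hc', fun i hi => ?_, ?_⟩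
      · have hi : i ≠ j ∧ i ∉ is := by simpa using hi
        simpa [hi.1] using hout i hi.2
      · rw [hstep]
        refine h.imp (fun h => ⟨?_, h.2⟩) (fun h => ⟨?_, h.2⟩)
        · simp [remaining, hy, hcj, ← hrem, h.1]
        · simp only [remaining, hy, hcj, ← hrem, h.1, hdir', (hout j hj).2, hn]
          ring
    -- One token crosses to the other stack and the digit drops by one; the higher digits stay.
    | succ a =>
      refine ⟨dir, update c j (fun z => if z = y then a else c j z + 1), none, fun i => ?_,
        fun i hi => ?_, .inr ⟨?_, ?_⟩⟩
      · by_cases h : i = j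
        · subst h
          have := hc i
          cases y <;> simp <;> omega
        · simp [h, hc]
      · have hi : i ≠ j ∧ i ∉ is := by simpa using hi
        simp [hi.1]
      · have : remaining n dir (update c j (fun z => if z = y then a else c j z + 1)) is =
            remaining n dir c is := remaining_congr fun i hi => by
          have : i ≠ j := fun h => hj (h ▸ hi)
          simp [this]
        simp [remaining, hy, hcj, this]
        ring
      · have hcc : update c j (update (update (c j) y a) (!y) (c j (!y) + 1)) =
            update c j (fun z => if z = y then a else c j z + 1) := by
          congr 1
          funext z
          cases y <;> cases z <;> simp
        rw [← hcc]
        cases y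
        all_goals
          simp [tick, hy, stepAux, update_clk, hcj, length_contents_clk, isSome_head?_contents_clk]

end Clocked

/-! ### The phases of a clocked run -/

namespace Clocked

open ClockedStack ClockedLabel Turing.TM2

variable {K Λ σ β : Type} [DecidableEq K] {Γ : K → Type} {d : ℕ}

section Contents

variable (S : ∀ k, List (Γ k)) (i r : List β) (b : Bool → List (Bool ⊕ β))
    (o : List (Bool ⊕ (Bool ⊕ β))) (c : Fin d → Bool → ℕ)

/-- Adds a token to the first stack of each digit in `is`. -/
def pushTokens (q : CStmt Γ Λ σ β d) : List (Fin d) → CStmt Γ Λ σ β d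
  | [] => q
  | j :: is => .push (.inr (clk j true)) (fun _ => token j true) (pushTokens q is)

theorem stepAux_pushTokens (q : CStmt Γ Λ σ β d) (v : ClockedState σ β d) {is : List (Fin d)}
    (his : is.Nodup) :
    stepAux (pushTokens q is) v (contents S i r b o c) =
      stepAux q v (contents S i r b o fun j z => if j ∈ is ∧ z = true then c j z + 1 else c j z) := by
  induction is generalizing c with
  | nil => simp [pushTokens]
  | cons j is ih =>
    obtain ⟨hj, his⟩ := List.nodup_cons.1 his
    simp only [pushTokens, stepAux, update_clk, ih _ his, List.length_cons, length_contents_clk]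
    congr 2
    funext j' z
    by_cases h : j' = j
    · subst h
      cases z <;> simp [hj]
    · simp [h]

omit [DecidableEq K] in
theorem contents_nil :
    (contents (fun _ => []) [] [] (fun _ => []) [] (fun _ _ => 0) :
      ∀ k, List (Alphabet Γ β d k)) = fun _ => [] := by
  funext k
  rcases k with k | k
  · rfl
  · cases k <;> rfl

end Contents

variable [Fintype K] [Inhabited β] (m : Λ → Stmt Γ Λ σ) (main : Λ) (v₀ : σ) (k₀ k₁ : K)
  (input : β → Γ k₀) (output : Γ k₁ → Bool)

/-- The input symbol that is held in the state. -/
def inputSymbol (v : ClockedState σ β d) : β := (v.sym.bind Sum.getRight?).getD default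

/-- The program of a clocked machine. It runs the machine with program `m` until the clock runs
out. It writes the output of that machine if there is one, and the input otherwise. -/
noncomputable def program : ClockedLabel Λ → CStmt Γ Λ σ β d
  | scan =>
    .pop (.inr inp) (fun v o => { v with sym := o.map .inr }) <|
    .branch (fun v => v.sym.isSome)
      (.push (.inr rev) (inputSymbol) <|
        .push (.inr (buf false)) (fun v => .inr (inputSymbol v)) <| .goto fun _ => scan)
      (.goto fun _ => fill)
  | fill =>
    .pop (.inr rev) (fun v o => { v with sym := o.map .inr }) <|
    .branch (fun v => v.sym.isSome)
      (.push (.inl k₀) (fun v => input (inputSymbol v)) <|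
        pushTokens (.goto fun _ => fill) (List.finRange d))
      (.goto fun _ => sim main)
  | sim l =>
    tick (liftStmt .inl (Alphabet Γ β d) ClockedState.inner (fun s v => { v with inner := s }) sim
      (.goto fun _ => collect) (m l)) (.goto fun _ => clean false) (List.finRange d)
  | collect =>
    .pop (.inl k₁) (fun v o => { v with sym := o.map fun s => .inl (output s) }) <|
    .branch (fun v => v.sym.isSome)
      (.push (.inr (buf true)) (fun v => v.sym.getD (.inl true)) <| .goto fun _ => collect)
      (.goto fun _ => clean true)
  | clean b =>
    drain (fun v => { v with sym := some (.inl true) }) (fun v => { v with sym := none })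
      (fun v => v.sym.isSome) ⟨v₀, fun _ => true, none⟩ (clean b) (emit b)
      (Finset.univ.filter (· ≠ .inr (buf b))).toList
  | emit b =>
    .pop (.inr (buf b)) (fun v o => { v with sym := o }) <|
    .branch (fun v => v.sym.isSome)
      (.push (.inr out) (fun v => .inr (v.sym.getD (.inl true))) <| .goto fun _ => emit b)
      (.push (.inr out) (fun _ => .inl (!b)) .halt)

variable (S : ∀ k, List (Γ k)) (i r : List β) (b : Bool → List (Bool ⊕ β))
    (o : List (Bool ⊕ (Bool ⊕ β))) (c : Fin d → Bool → ℕ) (dir : Fin d → Bool) (s : σ)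
    (x : Option (Bool ⊕ β))

local notation "prog" => step (program m main v₀ k₀ k₁ input output)

/-- The input is copied twice: `rev` feeds the simulated machine, while `buf false` saves the input
as the answer in case the clock runs out. -/
theorem stepsTo_scan :
    StepsTo prog (i.length + 1) ⟨some scan, ⟨s, dir, x⟩, contents S i r b o c⟩
      ⟨some fill, ⟨s, dir, none⟩, contents S [] (i.reverse ++ r)
        (update b false ((i.map .inr).reverse ++ b false)) o c⟩ := by
  induction i generalizing r b x with
  | nil =>
    refine .single ?_
    change some (⟨some fill, ⟨s, dir, none⟩, update (contents S [] r b o c) (.inr inp) []⟩ :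
      CCfg Γ Λ σ β d) = _
    erw [update_inp]
    simp
    rfl
  | cons a i ih =>
    have := ih (a :: r) (update b false (.inr a :: b false)) (some (.inr a))
    refine .head ?_ (by simpa using this)
    change some (⟨some scan, ⟨s, dir, some (.inr a)⟩, update
      (update (update (contents S (a :: i) r b o c)
      (.inr inp) i) (.inr rev) (a :: r)) (.inr (buf false)) (.inr a :: b false)⟩ : CCfg Γ Λ σ β d) =
        _
    erw [update_inp, update_rev, update_buf]
    rfl

/-- Emptying `rev` restores the order of the input. Each symbol adds one token to every digit, which
sets the base of the clock from the input length. -/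
theorem stepsTo_fill :
    StepsTo prog (r.length + 1) ⟨some fill, ⟨s, dir, x⟩, contents S i r b o c⟩
      ⟨some (sim main), ⟨s, dir, none⟩,
        contents (update S k₀ ((r.map input).reverse ++ S k₀)) i [] b o
          fun j z => if z then c j z + r.length else c j z⟩ := by
  induction r generalizing S c x with
  | nil =>
    refine .single ?_
    change some (⟨some (sim main), ⟨s, dir, none⟩, update (contents S i [] b o c) (.inr rev) []⟩ :
      CCfg Γ Λ σ β d) = _
    erw [update_rev]
    simp
    rfl
  | cons a r ih =>
    have := ih (update S k₀ (input a :: S k₀)) (fun j z => if z then c j z + 1 else c j z)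
      (some (.inr a))
    refine .head (b := ⟨some fill, ⟨s, dir, some (.inr a)⟩, contents
      (update S k₀ (input a :: S k₀)) i r b o (fun j z => if z then c j z + 1 else c j z)⟩) ?_ ?_
    · change some (stepAux (pushTokens (.goto fun _ => fill) (List.finRange d))
        ⟨s, dir, some (.inr a)⟩ (update (update (contents S i (a :: r) b o c) (.inr rev) r)
          (.inl k₀) (input a :: S k₀))) = _
      erw [update_rev, update_inl, stepAux_pushTokens _ _ _ _ _ _ _ _ (List.nodup_finRange d)]
      simp
      rfl
    · convert this using 3
      · simp
      · simp
      · funext j z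
        cases z <;> simp
        omega

theorem stepsTo_collect (u : List (Γ k₁)) (hu : S k₁ = u) :
    StepsTo prog (u.length + 1) ⟨some collect, ⟨s, dir, x⟩, contents S i r b o c⟩
      ⟨some (clean true), ⟨s, dir, none⟩, contents (update S k₁ []) i r
        (update b true ((u.map fun y => .inl (output y)).reverse ++ b true)) o c⟩ := by
  induction u generalizing S b x with
  | nil =>
    have h : contents (d := d) S i r b o c (.inl k₁) = [] := hu
    refine .single ?_
    simp only [step, program, stepAux, h]
    change some (⟨some (clean true), ⟨s, dir, none⟩, update (contents S i r b o c) (.inl k₁) []⟩ :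
      CCfg Γ Λ σ β d) = _
    erw [update_inl]
    simp
    rfl
  | cons a u ih =>
    have := ih (update S k₁ u) (update b true (.inl (output a) :: b true))
      (some (.inl (output a))) (by simp)
    refine .head ?_ (by simpa using this)
    have h : contents (d := d) S i r b o c (.inl k₁) = List.cons a u := hu
    simp only [step, program, stepAux, h]
    change some (⟨some collect, ⟨s, dir, some (.inl (output a))⟩, update
      (update (contents S i r b o c)
      (.inl k₁) u) (.inr (buf true)) (.inl (output a) :: b true)⟩ : CCfg Γ Λ σ β d) = _
    erw [update_inl, update_buf]
    rfl

/-- The buffer holds the answer reversed, so moving it restores the order; the tag is pushed last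
and thus comes first. -/
theorem stepsTo_emit (y : Bool) (l : List (Bool ⊕ β)) (hl : b y = l) :
    StepsTo prog (l.length + 1) ⟨some (emit y), ⟨s, dir, x⟩, contents S i r b o c⟩
      ⟨none, ⟨s, dir, none⟩,
        contents S i r (update b y []) (.inl (!y) :: ((l.map .inr).reverse ++ o)) c⟩ := by
  induction l generalizing b o x with
  | nil =>
    have h : contents (d := d) S i r b o c (.inr (buf y)) = [] := hl
    refine .single ?_
    simp only [step, program, stepAux, h]
    change some (⟨none, ⟨s, dir, none⟩, update (update (contents S i r b o c)
      (.inr (buf y)) []) (.inr out) (.inl (!y) :: o)⟩ : CCfg Γ Λ σ β d) = _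
    erw [update_buf, update_out]
    rfl
  | cons a l ih =>
    have := ih (update b y l) (.inr a :: o) (some a) (by simp)
    refine .head ?_ (by simpa using this)
    have h : contents (d := d) S i r b o c (.inr (buf y)) = List.cons a l := hl
    simp only [step, program, stepAux, h]
    change some (⟨some (emit y), ⟨s, dir, some a⟩, update (update (contents S i r b o c)
      (.inr (buf y)) l) (.inr out) (.inr a :: o)⟩ : CCfg Γ Λ σ β d) = _
    erw [update_buf, update_out]
    rfl

/-- The buffer to be emitted is the only stack exempt from `N`, as it is the only one not drained.
-/
theorem exists_stepsTo_clean (y : Bool) (N : ℕ) (hS : ∀ k, (S k).length ≤ N) (hi : i.length ≤ N)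
    (hr : r.length ≤ N) (hb : (b (!y)).length ≤ N) (ho : o.length ≤ N) (hc : ∀ j z, c j z ≤ N) :
    ∃ n ≤ N + 1, StepsTo prog n ⟨some (clean y), ⟨s, dir, x⟩, contents S i r b o c⟩
      ⟨some (emit y), ⟨v₀, fun _ => true, none⟩,
        contents (fun _ => []) [] [] (update (fun _ => []) y (b y)) [] fun _ _ => 0⟩ := by
  obtain ⟨n, hn, h⟩ := exists_stepsTo_drain (m := program m main v₀ k₀ k₁ input output)
    (l := clean y) rfl (fun _ => rfl) (fun _ => rfl) (fun _ => rfl) (Finset.nodup_toList _) N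
    ⟨s, dir, x⟩ (contents S i r b o c) (fun k hk => by
      have hk : k ≠ .inr (buf y) := by simpa using hk
      rcases k with k | k | k | z | k | ⟨j, z⟩
      · exact hS k
      · exact hi
      · exact hr
      · have : z = !y := by
          cases y <;> cases z <;> simp at hk ⊢
        subst this
        exact hb
      · exact ho
      · rw [length_contents_clk]
        exact hc j z)
  refine ⟨n, hn, ?_⟩
  convert h using 2
  rw [← update_buf (fun _ => []) [] [] (fun _ => []) [] (fun _ _ => 0) y (b y), contents_nil]
  refine Function.update_eq_iff.2 ⟨?_, fun k hk => ?_⟩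
  · simp; rfl
  · simp [hk]

theorem exists_stepsTo_clean_emit (y : Bool) (N : ℕ) (hS : ∀ k, (S k).length ≤ N)
    (hi : i.length ≤ N) (hr : r.length ≤ N) (hb : (b (!y)).length ≤ N) (ho : o.length ≤ N)
    (hc : ∀ j z, c j z ≤ N) (l : List (Bool ⊕ β)) (hl : b y = l) :
    ∃ n ≤ N + 1 + (l.length + 1), StepsTo prog n
      ⟨some (clean y), ⟨s, dir, x⟩, contents S i r b o c⟩
      ⟨none, ⟨v₀, fun _ => true, none⟩, contents (fun _ => []) [] [] (fun _ => [])
        (.inl (!y) :: (l.map .inr).reverse) fun _ _ => 0⟩ := by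
  obtain ⟨n, hn, h⟩ := exists_stepsTo_clean m main v₀ k₀ k₁ input output S i r b o c dir s x y N
    hS hi hr hb ho hc
  have h' := stepsTo_emit m main v₀ k₀ k₁ input output (fun _ => []) [] []
    (update (fun _ => []) y (b y)) [] (fun (_ : Fin d) _ => 0) (fun _ => true) v₀ none y l
    (by simp [hl])
  refine ⟨_, ?_, (h.trans h').trans (.refl _) |> (by simpa using ·)⟩
  omega

variable (n : ℕ) (hc : ∀ i, c i true + c i false = n)

include hc

/-- The tick and the lifted statement form a single statement, so a simulated step costs exactly one
step. -/
theorem exists_step_sim (l : Λ) :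
    ∃ dir' c' x', (∀ i, c' i true + c' i false = n) ∧
      ((remaining n dir c (List.finRange d) = 0 ∧
        prog ⟨some (sim l), ⟨s, dir, x⟩, contents S i r b o c⟩ =
          some ⟨some (clean false), ⟨s, dir', x'⟩, contents S i r b o c'⟩) ∨
      (remaining n dir c (List.finRange d) = remaining n dir' c' (List.finRange d) + 1 ∧
        ∀ a, step m ⟨some l, s, S⟩ = some a →
          prog ⟨some (sim l), ⟨s, dir, x⟩, contents S i r b o c⟩ =
            some ⟨some (a.l.elim collect sim), ⟨a.var, dir', none⟩, contents a.stk i r b o c'⟩)) := by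
  obtain ⟨dir₁, c₁, x₁, hc₁, -, h⟩ := tick_step
    (liftStmt .inl (Alphabet Γ β d) ClockedState.inner (fun s v => { v with inner := s }) sim
      (.goto fun _ => collect) (m l)) (.goto fun _ => clean false) n s S i r b o
      (List.nodup_finRange d) dir c hc x
  refine ⟨dir₁, c₁, x₁, hc₁, h.imp (fun h => ⟨h.1, congrArg some h.2⟩) fun h => ⟨h.1, ?_⟩⟩
  intro a ha
  have hlift := stepAux_liftStmt (e := .inl) (Γ' := Alphabet Γ β d) (get := ClockedState.inner)
    (set := fun s v => { v with inner := s }) (g := sim) (q₀ := .goto fun _ => collect)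
    (p := fun s => (⟨s, dir₁, none⟩ : ClockedState σ β d)) (ov := fun S => contents S i r b o c₁)
    (fun _ => rfl) (fun _ _ => rfl) (fun _ _ => rfl) (fun _ _ _ => update_inl _ _ _ _ _ _ _ _)
    (m l) s S
  obtain rfl : stepAux (m l) s S = a := Option.some.inj ha
  have helim (a : Cfg Γ Λ σ) : a.l.elim (stepAux (.goto fun _ => collect)
        (⟨a.var, dir₁, none⟩ : ClockedState σ β d) (contents a.stk i r b o c₁))
      (fun l => ⟨some (sim l), ⟨a.var, dir₁, none⟩, contents a.stk i r b o c₁⟩) =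
      ⟨some (a.l.elim collect sim), ⟨a.var, dir₁, none⟩, contents a.stk i r b o c₁⟩ := by
    obtain ⟨_ | _, _, _⟩ := a <;> rfl
  exact congrArg some ((h.2.trans hlift).trans (helim _))

theorem exists_stepsTo_sim_of_le (l : Λ) (t : ℕ) (s' : σ) (S' : ∀ k, List (Γ k))
    (h : StepsTo (step m) t ⟨some l, s, S⟩ ⟨none, s', S'⟩)
    (ht : t ≤ remaining n dir c (List.finRange d)) :
    ∃ dir' c', (∀ i, c' i true + c' i false = n) ∧
      StepsTo prog t ⟨some (sim l), ⟨s, dir, x⟩, contents S i r b o c⟩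
        ⟨some collect, ⟨s', dir', none⟩, contents S' i r b o c'⟩ := by
  induction t generalizing l s S dir c x with
  | zero => cases h
  | succ t ih =>
    obtain ⟨a, ha, h⟩ := h.exists_head
    obtain ⟨dir₁, c₁, x₁, hc₁, h₁ | h₁⟩ :=
      exists_step_sim m main v₀ k₀ k₁ input output S i r b o c dir s x n hc l
    · omega
    · have hstep := h₁.2 a ha
      obtain ⟨l' | l', s₁, S₁⟩ := a
      · cases t with
        | zero =>
          cases h
          exact ⟨dir₁, c₁, hc₁, .single hstep⟩
        | succ t =>
          obtain ⟨a, ha, -⟩ := h.exists_head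
          cases ha
      · obtain ⟨dir', c', hc', h'⟩ := ih S₁ c₁ dir₁ s₁ none hc₁ l' h (by omega)
        exact ⟨dir', c', hc', .head hstep h'⟩

/-- The machine is still running when the clock reaches zero; the additional step is the failing
tick. -/
theorem exists_stepsTo_sim_of_gt (l : Λ) (t : ℕ) (l' : Λ) (s' : σ) (S' : ∀ k, List (Γ k))
    (h : StepsTo (step m) t ⟨some l, s, S⟩ ⟨some l', s', S'⟩)
    (ht : remaining n dir c (List.finRange d) = t) :
    ∃ dir' c' x', (∀ i, c' i true + c' i false = n) ∧
      StepsTo prog (t + 1) ⟨some (sim l), ⟨s, dir, x⟩, contents S i r b o c⟩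
        ⟨some (clean false), ⟨s', dir', x'⟩, contents S' i r b o c'⟩ := by
  induction t generalizing l s S dir c x with
  | zero =>
    cases h
    obtain ⟨dir₁, c₁, x₁, hc₁, h₁ | h₁⟩ :=
      exists_step_sim m main v₀ k₀ k₁ input output S' i r b o c dir s' x n hc l'
    · exact ⟨dir₁, c₁, x₁, hc₁, .single h₁.2⟩
    · omega
  | succ t ih =>
    obtain ⟨a, ha, h⟩ := h.exists_head
    obtain ⟨dir₁, c₁, x₁, hc₁, h₁ | h₁⟩ :=
      exists_step_sim m main v₀ k₀ k₁ input output S i r b o c dir s x n hc l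
    · omega
    · have hstep := h₁.2 a ha
      obtain ⟨l₁ | l₁, s₁, S₁⟩ := a
      · cases t with
        | zero => cases h
        | succ t =>
          obtain ⟨a, ha, -⟩ := h.exists_head
          cases ha
      · obtain ⟨dir', c', x', hc', h'⟩ := ih S₁ c₁ dir₁ s₁ none hc₁ l₁ h (by omega)
        exact ⟨dir', c', x', hc', .head hstep h'⟩

end Clocked

namespace Turing

theorem length_update_nil_le {K : Type} [DecidableEq K] {Γ : K → Type} (k₀ : K) (l : List (Γ k₀))
    (k : K) : (update (fun k => ([] : List (Γ k))) k₀ l k).length ≤ l.length := by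
  by_cases h : k = k₀
  · subst h; simp
  · simp [h]

end Turing

/-! ### The clocked machine and its running time -/

namespace Clocked

open ClockedStack ClockedLabel Turing.TM2

variable {β : Type} [Finite β] [Inhabited β]

/-- The machine that runs `M` for fewer than `(n + 1) ^ d` steps on an input of length `n`. -/
noncomputable def machine (M : TM2ComputableAux β Bool) (d : ℕ) :
    TM2ComputableAux β (Bool ⊕ (Bool ⊕ β)) :=
  letI := M.tm.kFin
  letI := M.tm.ΛFin
  letI := M.tm.σFin
  letI : Fintype β := Fintype.ofFinite β
  { tm :=
      { K := M.tm.K ⊕ ClockedStack d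
        k₀ := .inr inp
        k₁ := .inr out
        Γ := Alphabet M.tm.Γ β d
        Λ := ClockedLabel M.tm.Λ
        main := scan
        σ := ClockedState M.tm.σ β d
        initialState := ⟨M.tm.initialState, fun _ => true, none⟩
        Γk₀Fin := inferInstanceAs (Fintype β)
        m := program M.tm.m M.tm.main M.tm.initialState M.tm.k₀ M.tm.k₁ M.inputAlphabet.symm
          M.outputAlphabet }
    inputAlphabet := Equiv.refl β
    outputAlphabet := Equiv.refl (Bool ⊕ (Bool ⊕ β)) }

variable (M : TM2ComputableAux β Bool) (d : ℕ)

theorem initList_machine (w : List β) :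
    initList (machine M d).tm (w.map (machine M d).inputAlphabet.symm) =
      ⟨some scan, ⟨M.tm.initialState, fun _ => true, none⟩,
        contents (fun _ => []) w [] (fun _ => []) [] fun _ _ => 0⟩ := by
  have h := update_inp (Γ := M.tm.Γ) (d := d) (fun _ => []) [] [] (fun _ => []) [] (fun _ _ => 0) w
  have hw : w.map (machine M d).inputAlphabet.symm = w := List.map_id w
  rw [contents_nil] at h
  rw [initList_eq, hw]
  exact congrArg (fun S => (⟨some scan, ⟨M.tm.initialState, fun _ => true, none⟩, S⟩ :
    CCfg M.tm.Γ M.tm.Λ M.tm.σ β d)) h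

theorem haltList_machine (u : List (Bool ⊕ (Bool ⊕ β))) :
    haltList (machine M d).tm (u.map (machine M d).outputAlphabet.symm) =
      ⟨none, ⟨M.tm.initialState, fun _ => true, none⟩,
        contents (fun _ => []) [] [] (fun _ => []) u fun _ _ => 0⟩ := by
  have h := update_out (Γ := M.tm.Γ) (d := d) (fun _ => []) [] [] (fun _ => []) [] (fun _ _ => 0) u
  have hu : u.map (machine M d).outputAlphabet.symm = u := List.map_id u
  rw [contents_nil] at h
  rw [haltList_eq, hu]
  exact congrArg (fun S => (⟨none, ⟨M.tm.initialState, fun _ => true, none⟩, S⟩ :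
    CCfg M.tm.Γ M.tm.Λ M.tm.σ β d)) h

theorem exists_polynomial_outputsInTime :
    ∃ p : Polynomial ℕ, ∀ (w : List β) (u : List Bool) (t : ℕ),
      StepsTo M.tm.step t (initList M.tm (w.map M.inputAlphabet.symm))
        (haltList M.tm (u.map M.outputAlphabet.symm)) →
      Nonempty (TM2OutputsInTime (machine M d).tm (w.map (machine M d).inputAlphabet.symm)
        (some ((if t < (w.length + 1) ^ d then .inl false :: u.map fun y => .inr (.inl y)
          else .inl true :: w.map fun y => .inr (.inr y)).map (machine M d).outputAlphabet.symm))
        (p.eval w.length)) := by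
  let := M.tm.kFin
  have := M.tm.ΛFin
  obtain ⟨B, hB⟩ := exists_growth_bound M.tm.m
  -- Scanning and filling take n + 1 steps each, the simulation at most T = (n+1)^d. Every stack
  -- involved has height at most n + T·B, which pays for collecting, cleaning and emitting.
  refine ⟨2 * (.X + 1) + (.X + 1) ^ d + 3 * (.X + (.X + 1) ^ d * .C B + 1), fun w u t h => ?_⟩
  rw [nonempty_TM2OutputsInTime, initList_machine, haltList_machine]
  rw [initList_eq, haltList_eq] at h
  obtain ⟨n, hn⟩ : ∃ n, n = w.length := ⟨_, rfl⟩
  obtain ⟨T, hT⟩ : ∃ T, T = (n + 1) ^ d := ⟨_, rfl⟩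
  have hp : Polynomial.eval n (2 * (.X + 1) + (.X + 1) ^ d + 3 * (.X + (.X + 1) ^ d * .C B + 1)) =
      2 * (n + 1) + T + 3 * (n + T * B + 1) := by simp [hT]
  rw [← hn, ← hT, hp]
  have hmono : ∀ t' ≤ T, n + t' * B ≤ n + T * B := fun t' h =>
    Nat.add_le_add_left (Nat.mul_le_mul_right B h) n
  obtain ⟨c₀, hc₀⟩ : ∃ c₀ : Fin d → Bool → ℕ, c₀ = fun _ z => if z then 0 + n else 0 := ⟨_, rfl⟩
  -- The clock allows T − 1 ticks, so t < T says exactly that the machine halts in time.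
  have hrem : remaining n (fun _ => true) c₀ (List.finRange d) + 1 = T := by
    simpa [hc₀, hT] using remaining_full n (List.finRange d)
  have hc : ∀ i, c₀ i true + c₀ i false = n := by simp [hc₀]
  have hclean : ∀ k, update (update (fun _ => []) M.tm.k₁ (u.map M.outputAlphabet.symm))
      M.tm.k₁ [] k = ([] : List (M.tm.Γ k)) := fun k => by simp
  have h₁ := (stepsTo_scan M.tm.m M.tm.main M.tm.initialState M.tm.k₀ M.tm.k₁
    M.inputAlphabet.symm M.outputAlphabet (fun _ => []) w [] (fun _ => []) []
    (fun (_ : Fin d) _ => 0) (fun _ => true) M.tm.initialState none).trans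
    (stepsTo_fill M.tm.m M.tm.main M.tm.initialState M.tm.k₀ M.tm.k₁
    M.inputAlphabet.symm M.outputAlphabet (fun _ => []) [] (w.reverse ++ [])
    (update (fun _ => []) false ((w.map .inr).reverse ++ [])) []
    (fun (_ : Fin d) _ => 0) (fun _ => true) M.tm.initialState none)
  simp only [List.append_nil, List.map_reverse, List.reverse_reverse, List.length_reverse,
    ← hn, ← hc₀] at h₁
  by_cases ht : t < T
  · rw [if_pos ht]
    obtain ⟨dir, c, hc', h₂⟩ := exists_stepsTo_sim_of_le M.tm.m M.tm.main M.tm.initialState M.tm.k₀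
      M.tm.k₁ M.inputAlphabet.symm M.outputAlphabet _ [] []
      (update (fun _ => []) false (w.map .inr).reverse) [] c₀ (fun _ => true) _ none n hc _ t _ _ h
      (by omega)
    have h₃ := stepsTo_collect M.tm.m M.tm.main M.tm.initialState M.tm.k₀
      M.tm.k₁ M.inputAlphabet.symm M.outputAlphabet
      (update (fun _ => []) M.tm.k₁ (u.map M.outputAlphabet.symm)) [] []
      (update (fun _ => []) false (w.map .inr).reverse) [] c dir M.tm.initialState none _
      (Function.update_self _ _ _)
    have hu : u.length ≤ n + t * B := by
      have := hB t _ _ h M.tm.k₁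
      have hl := length_update_nil_le M.tm.k₀ (w.map M.inputAlphabet.symm) M.tm.k₁
      simp only [Function.update_self, List.length_map] at this hl
      omega
    have := hmono t ht.le
    obtain ⟨a, ha, h₄⟩ := exists_stepsTo_clean_emit M.tm.m M.tm.main M.tm.initialState M.tm.k₀
      M.tm.k₁ M.inputAlphabet.symm M.outputAlphabet
      (update (update (fun _ => []) M.tm.k₁ (u.map M.outputAlphabet.symm)) M.tm.k₁ []) [] []
      (update (update (fun _ => []) false (w.map .inr).reverse) true (u.map .inl).reverse) [] c dir
      M.tm.initialState none true (n + T * B) (fun k => by rw [hclean k]; exact Nat.zero_le _)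
      (Nat.zero_le _) (Nat.zero_le _) (by simp [hn]) (Nat.zero_le _)
      (fun j z => by
        have := hc' j
        cases z <;> omega) _ (Function.update_self _ _ _)
    have hmap : (u.map M.outputAlphabet.symm).map (fun y => Sum.inl (M.outputAlphabet y)) =
        (u.map .inl : List (Bool ⊕ β)) := by simp
    have hnil : (u.map .inl).reverse ++ update (fun _ => []) false (w.map .inr).reverse true =
        ((u.map .inl).reverse : List (Bool ⊕ β)) := List.append_nil _
    rw [hmap, hnil] at h₃
    have h₅ := ((h₁.trans h₂).trans h₃).trans h₄
    simp only [List.map_reverse, List.reverse_reverse, List.map_map] at h₅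
    refine ⟨_, ?_, h₅⟩
    simp at ha ⊢
    omega
  · rw [if_neg ht]
    obtain ⟨R, hR⟩ : ∃ R, R = remaining n (fun _ => true) c₀ (List.finRange d) := ⟨_, rfl⟩
    -- The run is longer than `R`, so its configuration after `R` steps has a successor and cannot
    -- be halting.
    obtain ⟨e, rfl⟩ : ∃ e, t = R + (e + 1) := ⟨t - R - 1, by omega⟩
    obtain ⟨⟨l' | l', s', S'⟩, h, h'⟩ := h.exists_mid
    · obtain ⟨a, ha, -⟩ := h'.exists_head
      cases ha
    obtain ⟨dir, c, x, hc', h₂⟩ := exists_stepsTo_sim_of_gt M.tm.m M.tm.main M.tm.initialState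
      M.tm.k₀ M.tm.k₁ M.inputAlphabet.symm M.outputAlphabet _ [] []
      (update (fun _ => []) false (w.map .inr).reverse) [] c₀ (fun _ => true) _ none n hc _ R _ _ _
      h hR.symm
    have hS : ∀ k, (S' k).length ≤ n + T * B := fun k => by
      have hk := hB R _ _ h k
      have hl := length_update_nil_le M.tm.k₀ (w.map M.inputAlphabet.symm) k
      have := hmono R (by omega)
      simp only [List.length_map] at hk hl
      omega
    obtain ⟨a, ha, h₄⟩ := exists_stepsTo_clean_emit M.tm.m M.tm.main M.tm.initialState M.tm.k₀
      M.tm.k₁ M.inputAlphabet.symm M.outputAlphabet S' [] []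
      (update (fun _ => []) false (w.map .inr).reverse) [] c dir s' x false
      (n + T * B) hS (Nat.zero_le _) (Nat.zero_le _) (Nat.zero_le _) (Nat.zero_le _)
      (fun j z => by
        have := hc' j
        cases z <;> omega) _ (Function.update_self _ _ _)
    have h₅ := (h₁.trans h₂).trans h₄
    simp only [List.map_reverse, List.reverse_reverse, List.map_map] at h₅
    refine ⟨_, ?_, h₅⟩
    simp at ha ⊢
    omega

end Clocked

/-! ### Running one machine after another -/

/-- The final step of the inner machine executes `q₀` in place of halting, so the number of steps is
unchanged. -/
theorem Turing.TM2.stepsTo_liftStmt {K K' : Type} [DecidableEq K] [DecidableEq K']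
    {Λ Λ' σ σ' : Type}
    {e : K → K'} {Γ' : K' → Type} {get : σ' → σ} {set : σ → σ' → σ'} {g : Λ → Λ'}
    {q₀ : Stmt Γ' Λ' σ'} {p : σ → σ'} {ov : (∀ k, List (Γ' (e k))) → ∀ k', List (Γ' k')}
    (hget : ∀ s, get (p s) = s) (hset : ∀ s t, set s (p t) = p s)
    (hov : ∀ S k, ov S (e k) = S k)
    (hupdate : ∀ S k x, update (ov S) (e k) x = ov (update S k x))
    {m : Λ → Stmt (fun k => Γ' (e k)) Λ σ} {m' : Λ' → Stmt Γ' Λ' σ'}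
    (hm : ∀ l, m' (g l) = liftStmt e Γ' get set g q₀ (m l)) {l₀ : Option Λ'}
    (hq₀ : ∀ v S, stepAux q₀ v S = ⟨l₀, v, S⟩) {n : ℕ} {l : Λ} {s s' : σ}
    {S S' : ∀ k, List (Γ' (e k))} (h : StepsTo (step m) n ⟨some l, s, S⟩ ⟨none, s', S'⟩) :
    StepsTo (step m') n ⟨some (g l), p s, ov S⟩ ⟨l₀, p s', ov S'⟩ := by
  induction n generalizing l s S with
  | zero => cases h
  | succ n ih =>
    obtain ⟨a, ha, h⟩ := h.exists_head
    obtain rfl : stepAux (m l) s S = a := Option.some.inj ha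
    have hstep : step m' ⟨some (g l), p s, ov S⟩ = _ := congrArg some
      ((congrArg (stepAux · (p s) (ov S)) (hm l)).trans
        (stepAux_liftStmt hget hset hov hupdate (m l) s S))
    revert h hstep
    obtain ⟨l₁ | l₁, s₁, S₁⟩ := stepAux (m l) s S
    · intro h hstep
      cases n with
      | zero =>
        cases h
        exact .single (hstep.trans (congrArg some (hq₀ _ _)))
      | succ n =>
        obtain ⟨a, ha, -⟩ := h.exists_head
        cases ha
    · intro h hstep
      exact .head hstep (ih h)

/-- The labels of a machine that runs two machines after each other. -/
inductive HandoffLabel (Λ₁ Λ₂ : Type)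
  | first (l : Λ₁)
  | unload
  | route
  | second (l : Λ₂)
  deriving Fintype

/-- The states of a machine that runs two machines after each other. -/
structure HandoffState (σ₁ σ₂ γ : Type) where
  fst : σ₁
  snd : σ₂
  sym : Option γ

def HandoffState.equivProd (σ₁ σ₂ γ : Type) : HandoffState σ₁ σ₂ γ ≃ σ₁ × σ₂ × Option γ where
  toFun v := (v.fst, v.snd, v.sym)
  invFun v := ⟨v.1, v.2.1, v.2.2⟩

noncomputable instance {σ₁ σ₂ γ : Type} [Finite σ₁] [Finite σ₂] [Finite γ] :
    Fintype (HandoffState σ₁ σ₂ γ) :=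
  have := Finite.of_equiv _ (HandoffState.equivProd σ₁ σ₂ γ).symm
  Fintype.ofFinite _

namespace Handoff

open HandoffLabel Turing.TM2

variable {K₁ K₂ Λ₁ Λ₂ σ₁ σ₂ γ δ : Type} {Γ₁ : K₁ → Type} {Γ₂ : K₂ → Type}

/-- The alphabets of a machine that runs two machines after each other. -/
def Alphabet (Γ₁ : K₁ → Type) (Γ₂ : K₂ → Type) (γ : Type) : (K₁ ⊕ K₂) ⊕ Unit → Type
  | .inl (.inl k) => Γ₁ k
  | .inl (.inr k) => Γ₂ k
  | .inr _ => γ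

/-- The stacks of a machine that runs two machines after each other. -/
def contents (S₁ : ∀ k, List (Γ₁ k)) (S₂ : ∀ k, List (Γ₂ k)) (t : List γ) :
    ∀ k, List (Alphabet Γ₁ Γ₂ γ k)
  | .inl (.inl k) => S₁ k
  | .inl (.inr k) => S₂ k
  | .inr _ => t

theorem contents_nil :
    (contents (fun _ => []) (fun _ => []) [] : ∀ k, List (Alphabet Γ₁ Γ₂ γ k)) = fun _ => [] := by
  funext k
  obtain (k | k) | k := k <;> rfl

variable [DecidableEq K₁] [DecidableEq K₂]

section Update

variable (S₁ : ∀ k, List (Γ₁ k)) (S₂ : ∀ k, List (Γ₂ k)) (t : List γ)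

theorem update_first (k : K₁) (x : List (Alphabet Γ₁ Γ₂ γ (.inl (.inl k)))) :
    update (contents S₁ S₂ t) (.inl (.inl k)) x = contents (update S₁ k x) S₂ t := by
  refine Function.update_eq_iff.2 ⟨(Function.update_self k x S₁).symm, fun k' h => ?_⟩
  obtain (k' | k') | k' := k' <;> try rfl
  have h' : k' ≠ k := fun h' => h (h' ▸ rfl)
  exact (Function.update_of_ne h' x S₁).symm

theorem update_second (k : K₂) (x : List (Alphabet Γ₁ Γ₂ γ (.inl (.inr k)))) :
    update (contents S₁ S₂ t) (.inl (.inr k)) x = contents S₁ (update S₂ k x) t := by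
  refine Function.update_eq_iff.2 ⟨(Function.update_self k x S₂).symm, fun k' h => ?_⟩
  obtain (k' | k') | k' := k' <;> try rfl
  have h' : k' ≠ k := fun h' => h (h' ▸ rfl)
  exact (Function.update_of_ne h' x S₂).symm

theorem update_temp (x : List (Alphabet Γ₁ Γ₂ γ (.inr ()))) :
    update (contents S₁ S₂ t) (.inr ()) x = contents S₁ S₂ x := by
  refine Function.update_eq_iff.2 ⟨rfl, fun k' h => ?_⟩
  obtain (k' | k') | k' := k' <;> first | rfl | exact absurd rfl h

end Update

/-- The statements of a machine that runs two machines after each other. -/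
abbrev HStmt (Γ₁ : K₁ → Type) (Γ₂ : K₂ → Type) (Λ₁ Λ₂ σ₁ σ₂ γ δ : Type) : Type :=
  Stmt (Alphabet Γ₁ Γ₂ (Bool ⊕ (γ ⊕ δ))) (HandoffLabel Λ₁ Λ₂) (HandoffState σ₁ σ₂ (Bool ⊕ (γ ⊕ δ)))

/-- The configurations of a machine that runs two machines after each other. -/
abbrev HCfg (Γ₁ : K₁ → Type) (Γ₂ : K₂ → Type) (Λ₁ Λ₂ σ₁ σ₂ γ δ : Type) : Type :=
  Cfg (Alphabet Γ₁ Γ₂ (Bool ⊕ (γ ⊕ δ))) (HandoffLabel Λ₁ Λ₂) (HandoffState σ₁ σ₂ (Bool ⊕ (γ ⊕ δ)))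

variable [Inhabited γ] [Inhabited δ] (m₁ : Λ₁ → Stmt Γ₁ Λ₁ σ₁) (m₂ : Λ₂ → Stmt Γ₂ Λ₂ σ₂)
  (main₂ : Λ₂)
  (out₁ : K₁) (in₂ out₂ : K₂) (output₁ : Γ₁ out₁ → Bool ⊕ (γ ⊕ δ)) (input₂ : δ → Γ₂ in₂)
  (output₂ : γ → Γ₂ out₂)

/-- The program that runs the program `m₁` and inspects the tag of its output. For the tag `false`,
the rest is the output. For the tag `true`, the rest is passed to the program `m₂`. -/
def program : HandoffLabel Λ₁ Λ₂ → HStmt Γ₁ Γ₂ Λ₁ Λ₂ σ₁ σ₂ γ δ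
  | first l => liftStmt (fun k => .inl (.inl k)) (Alphabet Γ₁ Γ₂ _) HandoffState.fst
      (fun s v => { v with fst := s }) first (.goto fun _ => unload) (m₁ l)
  | unload =>
    .pop (.inl (.inl out₁)) (fun v o => { v with sym := o.map output₁ }) <|
    .branch (fun v => v.sym.isSome)
      (.push (.inr ()) (fun v => v.sym.getD (.inl true)) <| .goto fun _ => unload)
      (.goto fun _ => route)
  | route =>
    .pop (.inr ()) (fun v o => { v with sym := o }) <|
    .branch (fun v => (v.sym.bind Sum.getLeft?).isSome)
      (.branch (fun v => ((v.sym.bind Sum.getLeft?).getD true))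
        (.load (fun v => { v with sym := none }) (.goto fun _ => second main₂))
        (.load (fun v => { v with sym := none }) .halt))
      (.branch (fun v => ((v.sym.bind Sum.getRight?).bind Sum.getLeft?).isSome)
        (.push (.inl (.inr out₂))
          (fun v => output₂ (((v.sym.bind Sum.getRight?).bind Sum.getLeft?).getD default)) <|
          .goto fun _ => route)
        (.push (.inl (.inr in₂))
          (fun v => input₂ (((v.sym.bind Sum.getRight?).bind Sum.getRight?).getD default)) <|
          .goto fun _ => route))
  | second l => liftStmt (fun k => .inl (.inr k)) (Alphabet Γ₁ Γ₂ _) HandoffState.snd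
      (fun s v => { v with snd := s }) second .halt (m₂ l)

variable (S₁ : ∀ k, List (Γ₁ k)) (S₂ : ∀ k, List (Γ₂ k)) (t : List (Bool ⊕ (γ ⊕ δ)))
  (s₁ : σ₁) (s₂ : σ₂) (x : Option (Bool ⊕ (γ ⊕ δ)))

local notation "prog" => step (program m₁ m₂ main₂ out₁ in₂ out₂ output₁ input₂ output₂)

theorem stepsTo_first {n : ℕ} {l : Λ₁} {s₁' : σ₁} {S₁' : ∀ k, List (Γ₁ k)}
    (h : StepsTo (step m₁) n ⟨some l, s₁, S₁⟩ ⟨none, s₁', S₁'⟩) :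
    StepsTo prog n ⟨some (first l), ⟨s₁, s₂, x⟩, contents S₁ S₂ t⟩
      ⟨some unload, ⟨s₁', s₂, x⟩, contents S₁' S₂ t⟩ :=
  stepsTo_liftStmt (e := fun k => .inl (.inl k)) (Γ' := Alphabet Γ₁ Γ₂ _)
    (get := HandoffState.fst) (set := fun s v => { v with fst := s }) (g := first)
    (q₀ := .goto fun _ => unload) (l₀ := some unload)
    (p := fun s => (⟨s, s₂, x⟩ : HandoffState σ₁ σ₂ (Bool ⊕ (γ ⊕ δ))))
    (ov := fun S => contents S S₂ t) (fun _ => rfl) (fun _ _ => rfl) (fun _ _ => rfl)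
    (fun _ _ _ => update_first _ _ _ _ _) (fun _ => rfl) (fun _ _ => rfl) h

theorem stepsTo_second {n : ℕ} {l : Λ₂} {s₂' : σ₂} {S₂' : ∀ k, List (Γ₂ k)}
    (h : StepsTo (step m₂) n ⟨some l, s₂, S₂⟩ ⟨none, s₂', S₂'⟩) :
    StepsTo prog n ⟨some (second l), ⟨s₁, s₂, x⟩, contents S₁ S₂ t⟩
      ⟨none, ⟨s₁, s₂', x⟩, contents S₁ S₂' t⟩ :=
  stepsTo_liftStmt (e := fun k => .inl (.inr k)) (Γ' := Alphabet Γ₁ Γ₂ _)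
    (get := HandoffState.snd) (set := fun s v => { v with snd := s }) (g := second)
    (q₀ := .halt) (l₀ := none)
    (p := fun s => (⟨s₁, s, x⟩ : HandoffState σ₁ σ₂ (Bool ⊕ (γ ⊕ δ))))
    (ov := fun S => contents S₁ S t) (fun _ => rfl) (fun _ _ => rfl) (fun _ _ => rfl)
    (fun _ _ _ => update_second _ _ _ _ _) (fun _ => rfl) (fun _ _ => rfl) h

theorem stepsTo_unload (u : List (Γ₁ out₁)) (hu : S₁ out₁ = u) :
    StepsTo prog (u.length + 1) ⟨some unload, ⟨s₁, s₂, x⟩, contents S₁ S₂ t⟩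
      ⟨some route, ⟨s₁, s₂, none⟩,
        contents (update S₁ out₁ []) S₂ ((u.map output₁).reverse ++ t)⟩ := by
  induction u generalizing S₁ t x with
  | nil =>
    have h : contents S₁ S₂ t (.inl (.inl out₁)) = [] := hu
    refine .single ?_
    simp only [step, program, stepAux, h]
    change some (⟨some route, ⟨s₁, s₂, none⟩, update (contents S₁ S₂ t) (.inl (.inl out₁)) []⟩ :
      HCfg Γ₁ Γ₂ Λ₁ Λ₂ σ₁ σ₂ γ δ) = _
    erw [update_first]
    rfl
  | cons a u ih =>
    have := ih (update S₁ out₁ u) (output₁ a :: t) (some (output₁ a)) (by simp)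
    refine .head ?_ (by simpa using this)
    have h : contents S₁ S₂ t (.inl (.inl out₁)) = List.cons a u := hu
    simp only [step, program, stepAux, h]
    change some (⟨some unload, ⟨s₁, s₂, some (output₁ a)⟩, update (update (contents S₁ S₂ t)
      (.inl (.inl out₁)) u) (.inr ()) (output₁ a :: t)⟩ : HCfg Γ₁ Γ₂ Λ₁ Λ₂ σ₁ σ₂ γ δ) = _
    erw [update_first, update_temp]
    rfl

/-- The tag lies at the bottom of the reversed output and is met last. This does no harm: each
symbol shows by its own summand where it belongs, and the tag only decides how to continue. -/
theorem stepsTo_route_left (u : List γ) :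
    StepsTo prog (u.length + 1) ⟨some route, ⟨s₁, s₂, x⟩,
        contents S₁ S₂ ((u.map fun y => .inr (.inl y)) ++ [.inl false])⟩
      ⟨none, ⟨s₁, s₂, none⟩,
        contents S₁ (update S₂ out₂ ((u.map output₂).reverse ++ S₂ out₂)) []⟩ := by
  induction u generalizing S₂ x with
  | nil =>
    refine .single ?_
    change some (⟨none, ⟨s₁, s₂, none⟩, update (contents S₁ S₂ [.inl false]) (.inr ()) []⟩ :
      HCfg Γ₁ Γ₂ Λ₁ Λ₂ σ₁ σ₂ γ δ) = _
    erw [update_temp]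
    simp
    rfl
  | cons a u ih =>
    have := ih (update S₂ out₂ (output₂ a :: S₂ out₂)) (some (.inr (.inl a)))
    refine .head ?_ (by simpa using this)
    change some (⟨some route, ⟨s₁, s₂, some (.inr (.inl a))⟩, update (update (contents S₁ S₂
      (.inr (.inl a) :: ((u.map fun y => .inr (.inl y)) ++ [.inl false]))) (.inr ())
      ((u.map fun y => .inr (.inl y)) ++ [.inl false])) (.inl (.inr out₂))
      (output₂ a :: S₂ out₂)⟩ : HCfg Γ₁ Γ₂ Λ₁ Λ₂ σ₁ σ₂ γ δ) = _
    erw [update_temp, update_second]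
    rfl

theorem stepsTo_route_right (u : List δ) :
    StepsTo prog (u.length + 1) ⟨some route, ⟨s₁, s₂, x⟩,
        contents S₁ S₂ ((u.map fun y => .inr (.inr y)) ++ [.inl true])⟩
      ⟨some (second main₂), ⟨s₁, s₂, none⟩,
        contents S₁ (update S₂ in₂ ((u.map input₂).reverse ++ S₂ in₂)) []⟩ := by
  induction u generalizing S₂ x with
  | nil =>
    refine .single ?_
    change some (⟨some (second main₂), ⟨s₁, s₂, none⟩,
      update (contents S₁ S₂ [.inl true]) (.inr ()) []⟩ : HCfg Γ₁ Γ₂ Λ₁ Λ₂ σ₁ σ₂ γ δ) = _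
    erw [update_temp]
    simp
    rfl
  | cons a u ih =>
    have := ih (update S₂ in₂ (input₂ a :: S₂ in₂)) (some (.inr (.inr a)))
    refine .head ?_ (by simpa using this)
    change some (⟨some route, ⟨s₁, s₂, some (.inr (.inr a))⟩, update (update (contents S₁ S₂
      (.inr (.inr a) :: ((u.map fun y => .inr (.inr y)) ++ [.inl true]))) (.inr ())
      ((u.map fun y => .inr (.inr y)) ++ [.inl true])) (.inl (.inr in₂))
      (input₂ a :: S₂ in₂)⟩ : HCfg Γ₁ Γ₂ Λ₁ Λ₂ σ₁ σ₂ γ δ) = _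
    erw [update_temp, update_second]
    rfl

end Handoff

namespace Handoff

open HandoffLabel Turing.TM2

variable {β γ δ : Type} [Finite γ] [Finite δ] [Inhabited γ] [Inhabited δ]

/-- The machine that runs `M₁` and inspects the tag of its output. For the tag `false`, the rest is
the output. For the tag `true`, the rest is passed to `M₂`. -/
noncomputable def machine (M₁ : TM2ComputableAux β (Bool ⊕ (γ ⊕ δ))) (M₂ : TM2ComputableAux δ γ) :
    TM2ComputableAux β γ :=
  letI := M₁.tm.kFin
  letI := M₁.tm.ΛFin
  letI := M₁.tm.σFin
  letI := M₂.tm.kFin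
  letI := M₂.tm.ΛFin
  letI := M₂.tm.σFin
  { tm :=
      { K := (M₁.tm.K ⊕ M₂.tm.K) ⊕ Unit
        k₀ := .inl (.inl M₁.tm.k₀)
        k₁ := .inl (.inr M₂.tm.k₁)
        Γ := Alphabet M₁.tm.Γ M₂.tm.Γ (Bool ⊕ (γ ⊕ δ))
        Λ := HandoffLabel M₁.tm.Λ M₂.tm.Λ
        main := first M₁.tm.main
        σ := HandoffState M₁.tm.σ M₂.tm.σ (Bool ⊕ (γ ⊕ δ))
        initialState := ⟨M₁.tm.initialState, M₂.tm.initialState, none⟩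
        Γk₀Fin := M₁.tm.Γk₀Fin
        m := program M₁.tm.m M₂.tm.m M₂.tm.main M₁.tm.k₁ M₂.tm.k₀ M₂.tm.k₁ M₁.outputAlphabet
          M₂.inputAlphabet.symm M₂.outputAlphabet.symm }
    inputAlphabet := M₁.inputAlphabet
    outputAlphabet := M₂.outputAlphabet }

variable (M₁ : TM2ComputableAux β (Bool ⊕ (γ ⊕ δ))) (M₂ : TM2ComputableAux δ γ)

theorem initList_machine (w : List β) :
    initList (machine M₁ M₂).tm (w.map (machine M₁ M₂).inputAlphabet.symm) =
      ⟨some (first M₁.tm.main), ⟨M₁.tm.initialState, M₂.tm.initialState, none⟩,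
        contents (update (fun _ => []) M₁.tm.k₀ (w.map M₁.inputAlphabet.symm)) (fun _ => []) []⟩ := by
  have h := update_first (Γ₁ := M₁.tm.Γ) (Γ₂ := M₂.tm.Γ) (γ := Bool ⊕ (γ ⊕ δ)) (fun _ => [])
    (fun _ => []) [] M₁.tm.k₀ (w.map M₁.inputAlphabet.symm)
  rw [contents_nil] at h
  rw [initList_eq]
  exact congrArg (fun S => (⟨some (first M₁.tm.main),
    ⟨M₁.tm.initialState, M₂.tm.initialState, none⟩, S⟩ :
    HCfg M₁.tm.Γ M₂.tm.Γ M₁.tm.Λ M₂.tm.Λ M₁.tm.σ M₂.tm.σ γ δ)) h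

theorem haltList_machine (u : List γ) :
    haltList (machine M₁ M₂).tm (u.map (machine M₁ M₂).outputAlphabet.symm) =
      ⟨none, ⟨M₁.tm.initialState, M₂.tm.initialState, none⟩,
        contents (fun _ => []) (update (fun _ => []) M₂.tm.k₁ (u.map M₂.outputAlphabet.symm)) []⟩ := by
  have h := update_second (Γ₁ := M₁.tm.Γ) (Γ₂ := M₂.tm.Γ) (γ := Bool ⊕ (γ ⊕ δ)) (fun _ => [])
    (fun _ => []) [] M₂.tm.k₁ (u.map M₂.outputAlphabet.symm)
  rw [contents_nil] at h
  rw [haltList_eq]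
  exact congrArg (fun S => (⟨none,
    ⟨M₁.tm.initialState, M₂.tm.initialState, none⟩, S⟩ :
    HCfg M₁.tm.Γ M₂.tm.Γ M₁.tm.Λ M₂.tm.Λ M₁.tm.σ M₂.tm.σ γ δ)) h

/-- The first machine halts in its initial state with all stacks but its output empty, so nothing
needs to be cleaned. -/
theorem exists_stepsTo_machine_route :
    ∃ B, ∀ (w : List β) (out : List (Bool ⊕ (γ ⊕ δ))) (t : ℕ),
      StepsTo M₁.tm.step t (initList M₁.tm (w.map M₁.inputAlphabet.symm))
        (haltList M₁.tm (out.map M₁.outputAlphabet.symm)) →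
      out.length ≤ w.length + t * B ∧
      StepsTo (machine M₁ M₂).tm.step (t + (out.length + 1))
        (initList (machine M₁ M₂).tm (w.map (machine M₁ M₂).inputAlphabet.symm))
        ⟨some route, ⟨M₁.tm.initialState, M₂.tm.initialState, none⟩,
          contents (fun _ => []) (fun _ => []) out.reverse⟩ := by
  have := M₁.tm.ΛFin
  obtain ⟨B, hB⟩ := exists_growth_bound M₁.tm.m
  refine ⟨B, fun w out t h => ⟨?_, ?_⟩⟩
  · have hk := hB t _ _ h M₁.tm.k₁
    have hl := length_update_nil_le M₁.tm.k₀ (w.map M₁.inputAlphabet.symm) M₁.tm.k₁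
    simp only [initList_eq, haltList_eq, Function.update_self, List.length_map] at hk hl
    omega
  · rw [initList_machine]
    rw [initList_eq, haltList_eq] at h
    have h₁ := stepsTo_first M₁.tm.m M₂.tm.m M₂.tm.main M₁.tm.k₁ M₂.tm.k₀ M₂.tm.k₁
      M₁.outputAlphabet M₂.inputAlphabet.symm M₂.outputAlphabet.symm _ (fun _ => []) []
      M₁.tm.initialState M₂.tm.initialState none h
    have h₂ := stepsTo_unload M₁.tm.m M₂.tm.m M₂.tm.main M₁.tm.k₁ M₂.tm.k₀ M₂.tm.k₁
      M₁.outputAlphabet M₂.inputAlphabet.symm M₂.outputAlphabet.symm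
      (update (fun _ => []) M₁.tm.k₁ (out.map M₁.outputAlphabet.symm)) (fun _ => []) []
      M₁.tm.initialState M₂.tm.initialState none _ (Function.update_self _ _ _)
    have h₃ := h₁.trans h₂
    have hnil : update (update (fun _ => []) M₁.tm.k₁
      (out.map M₁.outputAlphabet.symm)) M₁.tm.k₁ [] =
        fun k => ([] : List (M₁.tm.Γ k)) := by simp
    have hout : ((out.map M₁.outputAlphabet.symm).map M₁.outputAlphabet).reverse ++ [] =
        out.reverse := by simp
    rw [hnil, hout, List.length_map] at h₃
    exact h₃

/-- The overhead is two passes, unloading and routing, over a tagged output of length at most |w| +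
t·B. -/
theorem exists_outputsInTime :
    ∃ B, ∀ (w : List β) (t : ℕ),
      (∀ u : List γ, StepsTo M₁.tm.step t (initList M₁.tm (w.map M₁.inputAlphabet.symm))
        (haltList M₁.tm ((.inl false :: u.map fun y => .inr (.inl y)).map M₁.outputAlphabet.symm)) →
        Nonempty (TM2OutputsInTime (machine M₁ M₂).tm
          (w.map (machine M₁ M₂).inputAlphabet.symm)
          (some (u.map (machine M₁ M₂).outputAlphabet.symm)) (t + 2 * (w.length + t * B + 1)))) ∧
      (∀ (z : List δ) (u : List γ) (t' : ℕ),
        StepsTo M₁.tm.step t (initList M₁.tm (w.map M₁.inputAlphabet.symm))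
          (haltList M₁.tm ((.inl true :: z.map fun y => .inr
            (.inr y)).map M₁.outputAlphabet.symm)) →
        StepsTo M₂.tm.step t' (initList M₂.tm (z.map M₂.inputAlphabet.symm))
          (haltList M₂.tm (u.map M₂.outputAlphabet.symm)) →
        Nonempty (TM2OutputsInTime (machine M₁ M₂).tm
          (w.map (machine M₁ M₂).inputAlphabet.symm)
          (some (u.map (machine M₁ M₂).outputAlphabet.symm))
          (t + 2 * (w.length + t * B + 1) + t'))) := by
  obtain ⟨B, hB⟩ := exists_stepsTo_machine_route M₁ M₂
  refine ⟨B, fun w t => ⟨fun u h => ?_, fun z u t' h h' => ?_⟩⟩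
  · obtain ⟨hlen, h₁⟩ := hB w _ t h
    have h₂ := stepsTo_route_left M₁.tm.m M₂.tm.m M₂.tm.main M₁.tm.k₁ M₂.tm.k₀ M₂.tm.k₁
      M₁.outputAlphabet M₂.inputAlphabet.symm M₂.outputAlphabet.symm (fun _ => []) (fun _ => [])
      M₁.tm.initialState M₂.tm.initialState none u.reverse
    have hrev : (u.reverse.map fun y => .inr (.inl y)) ++ [.inl false] =
        (Sum.inl false :: u.map fun y => .inr (.inl y) : List (Bool ⊕ (γ ⊕ δ))).reverse := by simp
    have hmap : (u.reverse.map M₂.outputAlphabet.symm).reverse ++ [] =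
        u.map M₂.outputAlphabet.symm := by simp
    rw [hrev, hmap] at h₂
    rw [nonempty_TM2OutputsInTime, haltList_machine]
    refine ⟨_, ?_, h₁.trans h₂⟩
    simp at hlen ⊢
    omega
  · obtain ⟨hlen, h₁⟩ := hB w _ t h
    have h₂ := stepsTo_route_right M₁.tm.m M₂.tm.m M₂.tm.main M₁.tm.k₁ M₂.tm.k₀ M₂.tm.k₁
      M₁.outputAlphabet M₂.inputAlphabet.symm M₂.outputAlphabet.symm (fun _ => []) (fun _ => [])
      M₁.tm.initialState M₂.tm.initialState none z.reverse
    have hrev : (z.reverse.map fun y => .inr (.inr y)) ++ [.inl true] =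
        (Sum.inl true :: z.map fun y => .inr (.inr y) : List (Bool ⊕ (γ ⊕ δ))).reverse := by simp
    have hmap : (z.reverse.map M₂.inputAlphabet.symm).reverse ++ [] =
        z.map M₂.inputAlphabet.symm := by simp
    rw [hrev, hmap] at h₂
    rw [initList_eq, haltList_eq] at h'
    have h₃ := stepsTo_second M₁.tm.m M₂.tm.m M₂.tm.main M₁.tm.k₁ M₂.tm.k₀ M₂.tm.k₁
      M₁.outputAlphabet M₂.inputAlphabet.symm M₂.outputAlphabet.symm (fun _ => []) _ []
      M₁.tm.initialState M₂.tm.initialState none h'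
    rw [nonempty_TM2OutputsInTime, haltList_machine]
    refine ⟨_, ?_, (h₁.trans h₂).trans h₃⟩
    simp at hlen ⊢
    omega

end Handoff

/-! ### Primitive recursive simulation of machines -/

theorem Primrec.of_finite_left {ι α σ : Type} [Finite ι] [Primcodable ι] [Primcodable α]
    [Primcodable σ] {f : ι → α → σ} (hf : ∀ i, Primrec (f i)) : Primrec₂ f := by
  obtain ⟨n, ⟨e⟩⟩ := Finite.exists_equiv_fin ι
  have h : Primrec₂ fun (j : Fin n) a => f (e.symm j) a := Primrec.fin_curry₁.2 fun j => hf _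
  exact (h.comp ((Primrec.dom_finite e).comp Primrec.fst) Primrec.snd).of_eq fun p => by simp

theorem Primrec.update_fin {α σ : Type} [Primcodable α] [Primcodable σ] {n : ℕ}
    {f : α → Fin n → σ} {g : α → σ} (hf : Primrec f) (j : Fin n) (hg : Primrec g) :
    Primrec fun a => update (f a) j (g a) := by
  refine Primrec.fin_curry.2 ?_
  have h : Primrec₂ fun (a : α) (i : Fin n) => if i = j then g a else f a i :=
    Primrec.ite (Primrec.eq.comp Primrec.snd (Primrec.const j)) (hg.comp Primrec.fst)
      (Primrec.fin_curry.1 hf)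
  exact h.of_eq fun a i => by simp [Function.update_apply]

namespace Turing.TM2

variable {K : Type} {Γ : K → Type} {Λ σ : Type}

/-- The symbols that a statement may push. -/
def Stmt.pushed : Stmt Γ Λ σ → Set (Σ k, Γ k)
  | .push k f q => (Set.range fun v => ⟨k, f v⟩) ∪ q.pushed
  | .peek _ _ q => q.pushed
  | .pop _ _ q => q.pushed
  | .load _ q => q.pushed
  | .branch _ q₁ q₂ => q₁.pushed ∪ q₂.pushed
  | .goto _ => ∅
  | .halt => ∅

theorem Stmt.finite_pushed [Finite σ] (q : Stmt Γ Λ σ) : q.pushed.Finite := by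
  induction q with
  | push k f q ih => exact (Set.finite_range _).union ih
  | peek k f q ih => exact ih
  | pop k f q ih => exact ih
  | load f q ih => exact ih
  | branch f q₁ q₂ ih₁ ih₂ => exact ih₁.union ih₂
  | goto f => exact Set.finite_empty
  | halt => exact Set.finite_empty

/-- Stack alphabets other than the input alphabet may be infinite, but only finitely many symbols
ever occur. Coding these in one finite type turns configurations into primitive recursive data. -/
theorem exists_finite_alphabet (U : Set (Σ k, Γ k)) (hU : U.Finite) :
    ∃ (D : Type) (_ : Finite D) (wr : ∀ k, Γ k → D) (rd : ∀ k, D → Option (Γ k)),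
      ∀ s ∈ U, rd s.1 (wr s.1 s.2) = some s.2 := by
  classical
  have := hU.to_subtype
  refine ⟨Option U, inferInstance, fun k x => if h : ⟨k, x⟩ ∈ U then some ⟨_, h⟩ else none,
    fun k o => o.bind fun u => if h : u.1.1 = k then some (h ▸ u.1.2) else none, ?_⟩
  rintro ⟨k, x⟩ h
  simp [h]

section Encode

variable {n : ℕ} {D : Type} (e : K → Fin n) (wr : ∀ k, Γ k → D) (rd : ∀ k, D → Option (Γ k))

/-- The effect of a statement on configurations in which all stack symbols are encoded in `D`. -/
def encodedStepAux : Stmt Γ Λ σ → σ × (Fin n → List D) → Option Λ × σ × (Fin n → List D)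
  | .push k f q, c => encodedStepAux q (c.1, update c.2 (e k) (wr k (f c.1) :: c.2 (e k)))
  | .peek k f q, c => encodedStepAux q (f c.1 ((c.2 (e k)).head?.bind (rd k)), c.2)
  | .pop k f q, c => encodedStepAux q
      (f c.1 ((c.2 (e k)).head?.bind (rd k)), update c.2 (e k) (c.2 (e k)).tail)
  | .load f q, c => encodedStepAux q (f c.1, c.2)
  | .branch f q₁ q₂, c => bif f c.1 then encodedStepAux q₁ c else encodedStepAux q₂ c
  | .goto f, c => (some (f c.1), c)
  | .halt, c => (none, c)

/-- The step function on encoded configurations, constant on halting configurations. -/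
def encodedStep (m : Λ → Stmt Γ Λ σ) (c : Option Λ × σ × (Fin n → List D)) :
    Option Λ × σ × (Fin n → List D) :=
  c.1.casesOn c fun l => encodedStepAux e wr rd (m l) c.2

/-- `S'` encodes the stacks `S`. -/
def EncodesStacks (S : ∀ k, List (Γ k)) (S' : Fin n → List D) : Prop :=
  ∀ k, S' (e k) = (S k).map (wr k) ∧ ∀ x ∈ S k, rd k (wr k x) = some x

variable {e wr rd}

theorem EncodesStacks.update [DecidableEq K] (he : Function.Injective e) {S : ∀ k, List (Γ k)}
    {S' : Fin n → List D} (h : EncodesStacks e wr rd S S') {k : K} {l : List (Γ k)}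
    (hl : ∀ x ∈ l, rd k (wr k x) = some x) :
    EncodesStacks e wr rd (update S k l) (update S' (e k) (l.map (wr k))) := by
  intro k'
  by_cases hk : k' = k
  · subst hk
    simpa using hl
  · simpa [hk, he.ne hk] using h k'

theorem EncodesStacks.head? {S : ∀ k, List (Γ k)} {S' : Fin n → List D}
    (h : EncodesStacks e wr rd S S') (k : K) : (S' (e k)).head?.bind (rd k) = (S k).head? := by
  rw [(h k).1]
  cases hS : S k with
  | nil => rfl
  | cons a l => simpa using (h k).2 a (by simp [hS])

/-- By the invariant, every symbol on a stack is decodable, so each read returns the true symbol;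
`hq` preserves this under pushes. -/
theorem encodedStepAux_spec [DecidableEq K] (he : Function.Injective e) (q : Stmt Γ Λ σ)
    (hq : ∀ s ∈ q.pushed, rd s.1 (wr s.1 s.2) = some s.2) {v : σ} {S : ∀ k, List (Γ k)}
    {S' : Fin n → List D} (h : EncodesStacks e wr rd S S') :
    (encodedStepAux e wr rd q (v, S')).1 = (stepAux q v S).l ∧
      (encodedStepAux e wr rd q (v, S')).2.1 = (stepAux q v S).var ∧
      EncodesStacks e wr rd (stepAux q v S).stk (encodedStepAux e wr rd q (v, S')).2.2 := by
  induction q generalizing v S S' with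
  | push k f q ih =>
    have h' := h.update he (k := k) (l := f v :: S k) fun x hx => by
      rcases List.mem_cons.1 hx with rfl | hx
      · exact hq _ (.inl ⟨v, rfl⟩)
      · exact (h k).2 x hx
    rw [List.map_cons, ← (h k).1] at h'
    exact ih (fun s hs => hq s (.inr hs)) h'
  | peek k f q ih =>
    simp only [encodedStepAux, stepAux, h.head?]
    exact ih hq h
  | pop k f q ih =>
    have h' := h.update he (k := k) (l := (S k).tail) fun x hx =>
      (h k).2 x (List.mem_of_mem_tail hx)
    rw [List.map_tail, ← (h k).1] at h'
    simp only [encodedStepAux, stepAux, h.head?]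
    exact ih hq h'
  | load f q ih => exact ih hq h
  | branch f q₁ q₂ ih₁ ih₂ =>
    simp only [encodedStepAux, stepAux]
    cases f v
    · exact ih₂ (fun s hs => hq s (.inr hs)) h
    · exact ih₁ (fun s hs => hq s (.inl hs)) h
  | goto f => exact ⟨rfl, rfl, h⟩
  | halt => exact ⟨rfl, rfl, h⟩

/-- Halting configurations are fixed points of `encodedStep`, so once halted the simulation stays
halted, and the halting time can be read off. -/
theorem isNone_encodedStep_iterate [DecidableEq K] (he : Function.Injective e)
    {m : Λ → Stmt Γ Λ σ} (hm : ∀ l, ∀ s ∈ (m l).pushed, rd s.1 (wr s.1 s.2) = some s.2) {t : ℕ}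
    {c : Cfg Γ Λ σ} {v' : σ} {T : ∀ k, List (Γ k)} (h : StepsTo (step m) t c ⟨none, v', T⟩)
    {S' : Fin n → List D} (hS : EncodesStacks e wr rd c.stk S') (j : ℕ) :
    ((encodedStep e wr rd m)^[j] (c.l, c.var, S')).1 = none ↔ t ≤ j := by
  induction t generalizing c S' j with
  | zero =>
    cases h
    have : (encodedStep e wr rd m)^[j] (none, v', S') = (none, v', S') :=
      Function.iterate_fixed rfl j
    simp [this]
  | succ t ih =>
    obtain ⟨a, ha, h⟩ := h.exists_head
    obtain ⟨l | l, v, S⟩ := c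
    · cases ha
    obtain rfl : stepAux (m l) v S = a := Option.some.inj ha
    cases j with
    | zero => simp
    | succ j =>
      obtain ⟨h₁, h₂, h₃⟩ := encodedStepAux_spec he (m l) (hm l) (v := v) hS
      rw [Function.iterate_succ_apply, Nat.succ_le_succ_iff, ← ih h h₃ j, ← h₁, ← h₂]
      rfl

end Encode

section Primrec

variable {n : ℕ} {D : Type} [Finite σ] [Finite D] [Finite Λ] [Primcodable σ] [Primcodable D]
  [Primcodable Λ] (e : K → Fin n) (wr : ∀ k, Γ k → D) (rd : ∀ k, D → Option (Γ k))

-- The statement is fixed, so its control functions are maps between finite types, hence primitive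
-- recursive; the rest is list operations.
omit [Finite Λ] in
theorem primrec_encodedStepAux (q : Stmt Γ Λ σ) : Primrec (encodedStepAux e wr rd q) := by
  have happ (k : K) : Primrec fun c : σ × (Fin n → List D) => c.2 (e k) :=
    Primrec.fin_app.comp Primrec.snd (Primrec.const _)
  have hread (k : K) (f : σ → Option (Γ k) → σ) : Primrec fun c : σ × (Fin n → List D) =>
      f c.1 ((c.2 (e k)).head?.bind (rd k)) :=
    (Primrec.dom_finite fun p : σ × Option D => f p.1 (p.2.bind (rd k))).comp
      (Primrec.fst.pair (Primrec.list_head?.comp (happ k)))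
  induction q with
  | push k f q ih =>
    exact ih.comp (Primrec.fst.pair (Primrec.update_fin Primrec.snd (e k)
      (Primrec.list_cons.comp ((Primrec.dom_finite fun v => wr k (f v)).comp Primrec.fst)
        (happ k))))
  | peek k f q ih => exact ih.comp ((hread k f).pair Primrec.snd)
  | pop k f q ih =>
    exact ih.comp ((hread k f).pair (Primrec.update_fin Primrec.snd (e k)
      (Primrec.list_tail.comp (happ k))))
  | load f q ih => exact ih.comp (((Primrec.dom_finite f).comp Primrec.fst).pair Primrec.snd)
  | branch f q₁ q₂ ih₁ ih₂ =>
    exact Primrec.cond ((Primrec.dom_finite f).comp Primrec.fst) ih₁ ih₂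
  | goto f =>
    exact (Primrec.option_some.comp ((Primrec.dom_finite f).comp Primrec.fst)).pair Primrec.id
  | halt => exact (Primrec.const none).pair Primrec.id

theorem primrec_encodedStep (m : Λ → Stmt Γ Λ σ) : Primrec (encodedStep e wr rd m) := by
  have h : Primrec₂ fun l c => encodedStepAux e wr rd (m l) c :=
    Primrec.of_finite_left fun l => primrec_encodedStepAux e wr rd (m l)
  exact Primrec.option_casesOn Primrec.fst Primrec.id
    (h.comp Primrec.snd (Primrec.snd.comp Primrec.fst)).to₂

end Primrec

end Turing.TM2

/-- Unbounded search for the least witness, which `h` makes total. -/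
theorem Computable.exists_nat_bound {p : ℕ → ℕ → Prop} (hp : PrimrecRel p) (h : ∀ n, ∃ t, p n t) :
    ∃ g : ℕ → ℕ, Computable g ∧ ∀ n, p n (g n) := by
  classical
  refine ⟨fun n => Nat.find (h n), ?_, fun n => Nat.find_spec (h n)⟩
  have hp' : Computable₂ fun n t => decide (p n t) := hp.decide.to_comp
  refine Partrec.of_eq_tot (Partrec.rfind hp'.partrec₂) fun n => Nat.mem_rfind.2 ⟨?_, ?_⟩
  · simpa using Nat.find_spec (h n)
  · intro t ht
    simpa using Nat.find_min (h n) ht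

namespace Turing

open TM2

@[reducible]
noncomputable def primcodableOfFinite (α : Type) [Finite α] : Primcodable α :=
  Primcodable.ofEquiv _ (Finite.equivFin α)

/-- The running time of a machine on finitely many computably listed words has a computable
bound. -/
theorem exists_computable_time_bound {β γ : Type} [Finite β] [Primcodable β]
    (M : TM2ComputableAux β γ) {L : ℕ → List (List β)} (hL : Primrec L)
    (h : ∀ N, ∀ w ∈ L N, ∃ t u,
      StepsTo M.tm.step t (initList M.tm (w.map M.inputAlphabet.symm)) (haltList M.tm u)) :
    ∃ g : ℕ → ℕ, Computable g ∧ ∀ N, ∀ w ∈ L N, ∀ t u,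
      StepsTo M.tm.step t (initList M.tm (w.map M.inputAlphabet.symm)) (haltList M.tm u) →
        t ≤ g N := by
  have := M.tm.kFin
  have := M.tm.ΛFin
  have := M.tm.σFin
  -- Only input symbols and pushed symbols can appear on a stack.
  have hU : ((Set.range fun x => (⟨M.tm.k₀, M.inputAlphabet.symm x⟩ : Σ k, M.tm.Γ k)) ∪
      ⋃ l, (M.tm.m l).pushed).Finite :=
    (Set.finite_range _).union (Set.finite_iUnion fun l => (M.tm.m l).finite_pushed)
  obtain ⟨D, _, wr, rd, hD⟩ := exists_finite_alphabet _ hU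
  obtain ⟨n, ⟨e⟩⟩ := Finite.exists_equiv_fin M.tm.K
  let := primcodableOfFinite M.tm.Λ
  let := primcodableOfFinite M.tm.σ
  let := primcodableOfFinite D
  let start (w : List β) : Option M.tm.Λ × M.tm.σ × (Fin n → List D) :=
    (some M.tm.main, M.tm.initialState,
      update (fun _ => []) (e M.tm.k₀) (w.map fun x => wr M.tm.k₀ (M.inputAlphabet.symm x)))
  have hstart : Primrec start :=
    (Primrec.const _).pair ((Primrec.const _).pair (Primrec.update_fin (Primrec.const _) _
      (Primrec.list_map Primrec.id
        ((Primrec.dom_finite fun x => wr M.tm.k₀ (M.inputAlphabet.symm x)).comp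
          Primrec.snd).to₂)))
  let halted (w : List β) (t : ℕ) : Prop :=
    ((encodedStep e wr rd M.tm.m)^[t] (start w)).1 = none
  have hhalted : PrimrecRel halted := by
    refine Primrec.eq.comp (Primrec.fst.comp (Primrec.nat_iterate Primrec.snd
      (hstart.comp Primrec.fst) ((primrec_encodedStep e wr rd M.tm.m).comp Primrec.snd).to₂))
      (Primrec.const none)
  have hiff (w : List β) (t : ℕ) (u : List (M.tm.Γ M.tm.k₁))
      (hw : StepsTo M.tm.step t (initList M.tm (w.map M.inputAlphabet.symm)) (haltList M.tm u))
      (j : ℕ) : halted w j ↔ t ≤ j := by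
    rw [initList_eq, haltList_eq] at hw
    have hnil : EncodesStacks e wr rd (fun k => ([] : List (M.tm.Γ k))) fun _ => [] :=
      fun k => ⟨rfl, by simp⟩
    have hS := hnil.update e.injective (k := M.tm.k₀) (l := w.map M.inputAlphabet.symm) (by
      intro x hx
      obtain ⟨y, -, rfl⟩ := List.mem_map.1 hx
      exact hD ⟨M.tm.k₀, M.inputAlphabet.symm y⟩ (.inl ⟨y, rfl⟩))
    rw [List.map_map] at hS
    exact isNone_encodedStep_iterate e.injective
      (fun l s hs => hD s (.inr (Set.mem_iUnion.2 ⟨l, hs⟩))) hw hS j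
  -- The bound is the first time by which all words in `L N` have halted. It exists because the sum
  -- of their running times has this property.
  obtain ⟨g, hg, hg'⟩ := Computable.exists_nat_bound
    (p := fun N t => ∀ w ∈ L N, halted w t) (hhalted.forall_mem_list.comp
      (hL.comp Primrec.fst) Primrec.snd) fun N => by
    choose! t u ht using h N
    refine ⟨((L N).map t).sum, fun w hw => (hiff w _ _ (ht w hw) _).2 ?_⟩
    exact List.single_le_sum (fun _ _ => Nat.zero_le _) _ (List.mem_map_of_mem hw)
  exact ⟨g, hg, fun N w hw t u ht => (hiff w t u ht _).1 (hg' N w hw)⟩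

end Turing

/-! ### Polynomial bounds and enumeration of small instances -/

/-- Each n^i is at most (n+1)^deg p, and the coefficients sum to p(1). -/
theorem Polynomial.eval_le_eval_one_mul_pow (p : Polynomial ℕ) (n : ℕ) :
    p.eval n ≤ p.eval 1 * (n + 1) ^ p.natDegree := by
  rw [Polynomial.eval_eq_sum_range, Polynomial.eval_eq_sum_range, Finset.sum_mul]
  refine Finset.sum_le_sum fun i hi => ?_
  rw [one_pow, mul_one]
  refine Nat.mul_le_mul_left _ ?_
  calc n ^ i ≤ (n + 1) ^ i := Nat.pow_le_pow_left n.le_succ i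
    _ ≤ (n + 1) ^ p.natDegree :=
      Nat.pow_le_pow_right n.succ_pos (Nat.lt_succ_iff.1 (Finset.mem_range.1 hi))

theorem Primrec.nat_pow_const (e : ℕ) : Primrec fun n : ℕ => n ^ e := by
  induction e with
  | zero => exact (Primrec.const 1).of_eq fun n => (pow_zero n).symm
  | succ e ih => exact (Primrec.nat_mul.comp ih Primrec.id).of_eq fun n => (pow_succ n e).symm

/-- The words of length at most `N` over an alphabet listed by `as`. -/
def List.wordsUpTo {α : Type} (as : List α) : ℕ → List (List α) :=
  Nat.rec [[]] fun _ ws => [] :: ws.flatMap fun x => as.map (· :: x)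

theorem List.mem_wordsUpTo {α : Type} {as : List α} (has : ∀ a, a ∈ as) {N : ℕ} {x : List α}
    (hx : x.length ≤ N) : x ∈ as.wordsUpTo N := by
  induction N generalizing x with
  | zero => simpa [List.wordsUpTo] using hx
  | succ N ih =>
    cases x with
    | nil => exact List.mem_cons_self
    | cons a x =>
      refine List.mem_cons_of_mem _ (List.mem_flatMap.2 ⟨x, ih (by simpa using hx), ?_⟩)
      exact List.mem_map.2 ⟨a, has a, rfl⟩

theorem Primrec.list_wordsUpTo {α : Type} [Primcodable α] (as : List α) :
    Primrec as.wordsUpTo := by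
  refine Primrec.nat_rec₁ _ (Primrec.list_cons.comp (Primrec.const []) ?_)
  exact Primrec.list_flatMap Primrec.snd (Primrec.list_map (Primrec.const as)
    (Primrec.list_cons.comp Primrec.snd (Primrec.snd.comp Primrec.fst)).to₂).to₂

theorem primrec_encode_instanceEncoding {α : Type} [Primcodable α] :
    Primrec (instanceEncoding α).encode := by
  have hu : Primrec unaryEncodeNat := by
    refine (Primrec.nat_rec₁ (α := List Bool) [] (f := fun _ l => true :: l)
      (Primrec.list_cons.comp (Primrec.const true) Primrec.snd)).of_eq fun n => ?_
    induction n with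
    | zero => rfl
    | succ n ih => exact congrArg _ ih
  exact Primrec.list_append.comp
    (Primrec.list_map Primrec.fst (Primrec.sumInl.comp Primrec.snd).to₂)
    (Primrec.list_map (hu.comp Primrec.snd) (Primrec.sumInr.comp Primrec.snd).to₂)

/-- The last clause matters because the machine for P is known to halt only on encodings of
instances. -/
theorem exists_primrec_instances (α : Type) [Finite α] [Primcodable α] :
    ∃ L : ℕ → List (List (α ⊕ Bool)), Primrec L ∧
      (∀ N x k, x.length ≤ N → k ≤ N → (instanceEncoding α).encode (x, k) ∈ L N) ∧
      ∀ N, ∀ w ∈ L N, ∃ y, (instanceEncoding α).encode y = w := by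
  have := Fintype.ofFinite α
  refine ⟨fun N => (Finset.univ.toList.wordsUpTo N).flatMap fun x =>
    (List.range (N + 1)).map fun k => (instanceEncoding α).encode (x, k), ?_, ?_, ?_⟩
  · exact Primrec.list_flatMap (Primrec.list_wordsUpTo _) (Primrec.list_map
      (Primrec.list_range.comp (Primrec.succ.comp Primrec.fst))
      (primrec_encode_instanceEncoding.comp
        ((Primrec.snd.comp Primrec.fst).pair Primrec.snd)).to₂).to₂
  · intro N x k hx hk
    refine List.mem_flatMap.2 ⟨x, List.mem_wordsUpTo (by simp) hx, ?_⟩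
    exact List.mem_map.2 ⟨k, List.mem_range.2 (Nat.lt_succ_iff.2 hk), rfl⟩
  · intro N w hw
    obtain ⟨x, -, hw⟩ := List.mem_flatMap.1 hw
    obtain ⟨k, -, rfl⟩ := List.mem_map.1 hw
    exact ⟨_, rfl⟩

/-! ### The two implications -/

theorem FPTCounting.hasCountingKernel {α : Type} [Finite α] {P : List α × ℕ → ℕ}
    (h : FPTCounting P) : HasCountingKernel P := by
  obtain ⟨f, hf, M, c, hM⟩ := h
  -- An arbitrary symbol, read only when the state holds none.
  have : Inhabited (α ⊕ Bool) := ⟨.inr false⟩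
  simp only [nonempty_TM2OutputsInTime] at hM
  choose t ht hsteps using hM
  -- The exponent exceeds that of the running time by one, so that a timeout leaves one factor n + 1
  -- to be bounded by `f k`.
  let A (y : List α × ℕ) : ℕ ⊕ (List α × ℕ) :=
    if t y.1 y.2 < (((instanceEncoding α).encode y).length + 1) ^ (c + 1) then .inl (P y)
    else .inr y
  obtain ⟨p, hp⟩ := Clocked.exists_polynomial_outputsInTime M (c + 1)
  refine ⟨f, hf, A, ⟨⟨Clocked.machine M (c + 1), p, fun y => ?_⟩⟩, fun x k => ?_⟩
  · have hy := (hp _ _ _ (hsteps y.1 y.2)).some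
    have hA : (encodingSum encodingNatBool (instanceEncoding α)).encode (A y) =
        if t y.1 y.2 < (((instanceEncoding α).encode y).length + 1) ^ (c + 1) then
          .inl false :: (encodingNatBool.encode (P y)).map fun s => .inr (.inl s)
        else .inl true :: ((instanceEncoding α).encode y).map fun s => .inr (.inr s) := by
      simp only [A]
      split_ifs <;> rfl
    rw [hA]
    exact hy
  · by_cases hlt : t x k < (((instanceEncoding α).encode (x, k)).length + 1) ^ (c + 1)
    · exact .inl (if_pos hlt)
    · refine .inr ⟨x, k, if_neg hlt, ?_⟩
      rw [length_instanceEncoding, not_lt] at hlt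
      have hle : x.length + k + 1 ≤ f k := by
        refine Nat.le_of_mul_le_mul_right (c := (x.length + k + 1) ^ c) ?_ (by positivity)
        calc (x.length + k + 1) * (x.length + k + 1) ^ c
            = (x.length + k + 1) ^ (c + 1) := (pow_succ' _ _).symm
          _ ≤ f k * max x.length 1 ^ c := hlt.trans (ht x k)
          _ ≤ f k * (x.length + k + 1) ^ c := by
            gcongr
            omega
      exact ⟨by omega, by omega, rfl⟩

theorem HasCountingKernel.fptCounting {α : Type} [Finite α] {P : List α × ℕ → ℕ}
    (hP : ComputableCounting P) (h : HasCountingKernel P) : FPTCounting P := by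
  obtain ⟨f, hf, A, ⟨K⟩, hA⟩ := h
  obtain ⟨Q⟩ := hP
  have : Inhabited (α ⊕ Bool) := ⟨.inr false⟩
  let := primcodableOfFinite α
  have hQ (y : List α × ℕ) := (Q.outputsFun y).exists_stepsTo
  obtain ⟨L, hL, hmem, hL'⟩ := exists_primrec_instances α
  obtain ⟨g, hg, hgt⟩ := exists_computable_time_bound Q.toTM2ComputableAux hL fun N w hw => by
    obtain ⟨y, rfl⟩ := hL' N w hw
    obtain ⟨t, ht⟩ := hQ y
    exact ⟨t, _, ht⟩
  obtain ⟨B, hB⟩ := Handoff.exists_outputsInTime K.toTM2ComputableAux Q.toTM2ComputableAux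
  -- The time of the kernelization together with the overhead of the handoff.
  let p : Polynomial ℕ := K.time + 2 * (Polynomial.X + K.time * Polynomial.C B + 1)
  have hp (n : ℕ) : p.eval n = K.time.eval n + 2 * (n + K.time.eval n * B + 1) := by simp [p]
  -- With n = |x| + k, p(n) ≤ p(1)·(n+1)^deg p and n + 1 ≤ (k+2)·max(|x|,1); the second summand
  -- bounds the run on the kernel.
  refine ⟨fun k => p.eval 1 * (k + 2) ^ p.natDegree + g (f k), ?_,
    Handoff.machine K.toTM2ComputableAux Q.toTM2ComputableAux, p.natDegree, fun x k => ?_⟩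
  · have hpow : Primrec fun k => p.eval 1 * (k + 2) ^ p.natDegree :=
      Primrec.nat_mul.comp (Primrec.const _) ((Primrec.nat_pow_const _).comp
        (Primrec.succ.comp Primrec.succ))
    exact Primrec.nat_add.to_comp.comp hpow.to_comp (hg.comp hf)
  · obtain ⟨t, ht, hK⟩ := nonempty_TM2OutputsInTime.1 ⟨K.outputsFun (x, k)⟩
    have hpoly : p.eval (x.length + k) ≤
        p.eval 1 * (k + 2) ^ p.natDegree * max x.length 1 ^ p.natDegree := by
      rw [mul_assoc, ← mul_pow]
      refine (p.eval_le_eval_one_mul_pow _).trans ?_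
      gcongr
      have h₁ : x.length ≤ max x.length 1 := le_max_left _ _
      have h₂ : k + 1 ≤ (k + 1) * max x.length 1 := Nat.le_mul_of_pos_right _ (by positivity)
      linarith
    -- This lets `g (f k)` be absorbed into the product with the power of max(|x|,1).
    have hone : 1 ≤ max x.length 1 ^ p.natDegree := Nat.one_le_pow _ _ (by positivity)
    have htime : t + 2 * (((instanceEncoding α).encode (x, k)).length + t * B + 1) ≤
        p.eval (x.length + k) := by
      rw [length_instanceEncoding] at ht ⊢
      rw [hp]
      gcongr
    rw [add_mul]
    rcases hA x k with hxk | ⟨x', k', hxk, hx', hk', hPeq⟩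
    · rw [hxk] at hK
      obtain ⟨n, hn, hs⟩ := nonempty_TM2OutputsInTime.1 ((hB _ t).1 _ hK)
      exact nonempty_TM2OutputsInTime.2
        ⟨n, (hn.trans (htime.trans hpoly)).trans (Nat.le_add_right _ _), hs⟩
    · rw [hxk] at hK
      obtain ⟨t', ht'⟩ := hQ (x', k')
      have hg' : t' ≤ g (f k) := hgt _ _ (hmem _ _ _ hx' hk') _ _ ht'
      obtain ⟨n, hn, hs⟩ := nonempty_TM2OutputsInTime.1 ((hB _ t).2 _ _ t' hK ht')
      rw [hPeq]
      exact nonempty_TM2OutputsInTime.2 ⟨n, hn.trans (Nat.add_le_add (htime.trans hpoly)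
        (hg'.trans (Nat.le_mul_of_pos_right _ hone))), hs⟩

theorem mainTheorem8 {α : Type} [Finite α] (P : List α × ℕ → ℕ) (hP : ComputableCounting P) :
    FPTCounting P ↔ HasCountingKernel P :=
  ⟨FPTCounting.hasCountingKernel, HasCountingKernel.fptCounting hP⟩
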